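/- **Theorem (total complexity of iALM with convex constraints).** Consider $$\min_{x\in\mathbb R^n}\ f_0(x):=g(x)+h(x)\quad\text{s.t.}\quad Ax=b,\ \ f(x)\le 0, \qquad(\ast)$$ where $A\in\mathbb R^{l\times n}$, $b\in\mathbb R^l$, $f=(f_1,\dots,f_m)$. Assume that $g$ is $L_0$-smooth and $\rho_0$-weakly convex with $\rho_0>0$ (i.e. $g+\frac{\rho_0}2\|\cdot\|^2$ is convex), that $h$ is a closed convex function with nonempty compact domain $\operatorname{dom}h$, and that each $f_i$ is convex and $L_i^f$-smooth on $\mathbb R^n$. Let $B_i^f$ be any constants with $$B_i^f\ \ge\ \max\{|f_i(u)|,\|\nabla f_i(u)\|\}\quad\text{for all } u\in\{2x-x' : x,x'\in\operatorname{dom}h\}.$$ $J_f$ is the Jacobian of $f$, $[\cdot]_+$ the componentwise positive part, $\|\cdot\|$ the Euclidean/spectral norm, and $\partial f_0=\nabla g+\partial h$. A point $x$ is an *$\varepsilon$-KKT point* of $(\ast)$ if there are $y\in\mathbb R^l$ and $z\in\mathbb R^m$, $z\ge 0$, with $$\|Ax-b\|\le\varepsilon,\quad \|[f(x)]_+\|\le\varepsilon,\quad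 \operatorname{dist}\big(0,\partial f_0(x)+A^\top y+J_f(x)^\top z\big)\le\varepsilon,\quad \sum_{i=1}^m|z_if_i(x)|\le\varepsilon .$$ *Inner method* $\mathrm{APG}(G,h,\mu,L,\delta)$: choose any $\bar x^{-1}\in\operatorname{dom}h$, put $\alpha=\sqrt{\mu/L}$ and $\bar x^0=x^0=T(\bar x^{-1})$, where $T(\bar x)=\arg\min_x\langle\nabla G(\bar x),x\rangle+\frac L2\|x-\bar x\|^2+h(x)$. Iteration $t=0,1,\dots$: $x^{t+1}=T(\bar x^t)$, $\bar x^{t+1}=x^{t+1}+\frac{1-\alpha}{1+\alpha}(x^{t+1}-x^t)$; output $x^{t+1}$ and stop if $\operatorname{dist}(-\nabla G(x^{t+1}),\partial h(x^{t+1}))\le\delta$. *Middle method* $\mathrm{iPPM}(\phi,h,x^0,\rho,L_\phi,\varepsilon)$: for $j=0,1,\dots$ let $x^{j+1}$ be the output of $\mathrm{APG}(\phi+\rho\|\cdot-x^j\|^2,\,h,\,\rho,\,L_\phi+2\rho,\,\varepsilon/4)$; return $x^{j+1}$ if $2\rho\|x^{j+1}-x^j\|\le\varepsilon/2$. *Outer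 method (iALM)*, with parameters $\beta_0>0$, $\sigma>1$, $w_0>0$ and $x^0\in\operatorname{dom}h$, $y^0=0$, $z^0=0$: for $k=0,1,\dots$ let $\beta_k=\beta_0\sigma^k$, $$\phi_k(x)=g(x)+\langle y^k,Ax-b\rangle+\tfrac{\beta_k}2\|Ax-b\|^2+\tfrac1{2\beta_k}\big(\|[z^k+\beta_kf(x)]_+\|^2-\|z^k\|^2\big),$$ $$\hat L_k=L_0+\beta_k\|A^\top A\|+\sum_{i=1}^m\big(\beta_kB_i^f(B_i^f+L_i^f)+L_i^f|z_i^k|\big),$$ $x^{k+1}=\mathrm{iPPM}(\phi_k,h,x^k,\rho_0,\hat L_k,\varepsilon)$, and $$y^{k+1}=y^k+w_k(Ax^{k+1}-b),\qquad z_i^{k+1}=z_i^k+w_k\max\{-z_i^k/\beta_k,\ f_i(x^{k+1})\},$$ $$w_k=w_0\min\Big\{1,\frac{\gamma_k}{\max\{\|Ax^{k+1}-b\|,\|[f(x^{k+1})]_+\|\}},\frac{\beta_k}{w_0}\Big\},\qquad \gamma_k=\frac{(\log2)^2\min\{\|Ax^0-b\|,\|[f(x^0)]_+\|\}}{(k+1)[\log(k+2)]^2}$$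 (a quotient with zero denominator is read as $+\infty$). Fix the problem, the constants and parameters above, $x^0$, a number $v>0$ and a number $\varepsilon_{\max}>0$. Then there are $C\in\mathbb R$ and $p\in\mathbb N$ such that for every $\varepsilon\in(0,\varepsilon_{\max}]$ and all choices of the initial points $\bar x^{-1}\in\operatorname{dom}h$ of the APG calls the following holds. If the outer iterates of the method satisfy the generalized regularity condition $$v\sqrt{\|Ax^k-b\|^2+\|[f(x^k)]_+\|^2}\ \le\ \operatorname{dist}\Big(-A^\top(Ax^k-b)-J_f(x^k)^\top[f(x^k)]_+,\ \frac{\partial h(x^k)}{\beta_{k-1}}\Big)\qquad\text{for all }k\ge1,$$ then the method produces an outer iterate $x^k$, $k\ge 1$, that is an $\varepsilon$-KKT point of $(\ast)$ within a total of at most $$C\,\varepsilon^{-5/2}\,(1+|\log\varepsilon|)^p$$ APG iterations, i.e. within $\tilde O(\varepsilon^{-5/2})$ APG iterations. -/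

import Mathlib

open scoped RealInnerProductSpace Pointwise

namespace IALM

/-- `ℝⁿ` with the Euclidean norm. -/
abbrev Vec (n : ℕ) := EuclideanSpace ℝ (Fin n)

/-- A differentiable function on `ℝⁿ` whose gradient is Lipschitz with constant `L`. -/
def LSmooth {n : ℕ} (φ : Vec n → ℝ) (L : ℝ) : Prop :=
  Differentiable ℝ φ ∧ ∀ x y : Vec n, ‖gradient φ x - gradient φ y‖ ≤ L * ‖x - y‖

/-- `φ + (ρ/2)‖·‖²` is convex on `ℝⁿ`. -/
def WeaklyConvex {n : ℕ} (φ : Vec n → ℝ) (ρ : ℝ) : Prop :=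
  ConvexOn ℝ Set.univ (fun x => φ x + ρ / 2 * ‖x‖ ^ 2)

/-- The convex subdifferential at `x` of the extended-valued function that equals `H` on `D` and
`+∞` off `D` (empty for `x ∉ D`). -/
def subdiff {n : ℕ} (D : Set (Vec n)) (H : Vec n → ℝ) (x : Vec n) : Set (Vec n) :=
  {s | x ∈ D ∧ ∀ u ∈ D, H x + ⟪s, u - x⟫ ≤ H u}

/-- Componentwise positive part of a vector. -/
noncomputable def pos {m : ℕ} (a : Vec m) : Vec m := WithLp.toLp 2 (fun i => max (a i) 0)

/-! ### The accelerated proximal gradient method (APG) for `min G + H`, with `dom H = D` -/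

/-- `argmin_x ⟨∇G(xb), x⟩ + (L/2)‖x - xb‖² + H(x)`, the minimum over `dom H = D`. -/
noncomputable def proxGrad {n : ℕ} (D : Set (Vec n)) (H G : Vec n → ℝ) (L : ℝ) (xb : Vec n) :
    Vec n :=
  Classical.epsilon fun x => x ∈ D ∧
    IsMinOn (fun u => ⟪gradient G xb, u⟫ + L / 2 * ‖u - xb‖ ^ 2 + H u) D x

/-- The iterate `x^t` and the extrapolated point `x̄^t` of APG. -/
structure APGState (n : ℕ) where
  x : Vec n
  xbar : Vec n

/-- Initialization of APG from the chosen point `x̄^{-1}`. -/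
noncomputable def apgInit {n : ℕ} (D : Set (Vec n)) (H G : Vec n → ℝ) (L : ℝ) (xm : Vec n) :
    APGState n :=
  ⟨proxGrad D H G L xm, proxGrad D H G L xm⟩

/-- One iteration of APG, with strong convexity modulus `μ` and smoothness constant `L`. -/
noncomputable def apgStep {n : ℕ} (D : Set (Vec n)) (H G : Vec n → ℝ) (μ L : ℝ)
    (a : APGState n) : APGState n :=
  let α := √(μ / L)
  let x := proxGrad D H G L a.xbar
  ⟨x, x + ((1 - α) / (1 + α)) • (x - a.x)⟩

/-- The stopping test `dist(-∇G(x), ∂H(x)) ≤ δ` of APG. -/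
def apgTest {n : ℕ} (D : Set (Vec n)) (H G : Vec n → ℝ) (δ : ℝ) (x : Vec n) : Prop :=
  Metric.infEDist (-gradient G x) (subdiff D H x) ≤ ENNReal.ofReal δ

/-! ### The constrained problem -/

/-- The data of `min g(x) + h(x)` subject to `A x = b` and `f_i(x) ≤ 0`. The closed convex
function `h` is given by its effective domain `dom` and its finite values there. -/
structure Problem (n l m : ℕ) where
  g : Vec n → ℝ
  dom : Set (Vec n)
  h : Vec n → ℝ
  A : Vec n →L[ℝ] Vec l
  b : Vec l
  f : Fin m → Vec n → ℝ

/-- The constants used by the algorithm: smoothness and weak convexity constants of `g`,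
smoothness constants and bounds for the `f_i`, and the parameters `β₀`, `σ`, `w₀`. -/
structure Params (m : ℕ) where
  L₀ : ℝ
  ρ₀ : ℝ
  Lf : Fin m → ℝ
  Bf : Fin m → ℝ
  β₀ : ℝ
  σ : ℝ
  w₀ : ℝ

namespace Problem

variable {n l m : ℕ} (P : Problem n l m)

/-- The vector `f(x) = (f_1(x), …, f_m(x))`. -/
noncomputable def fvec (x : Vec n) : Vec m := WithLp.toLp 2 (fun i => P.f i x)

/-- `J_f(x)ᵀ z`. -/
noncomputable def jacT (x : Vec n) (z : Vec m) : Vec n := ∑ i, z i • gradient (P.f i) x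

/-- The points `2x - x'` with `x, x' ∈ dom h`. This set contains `dom h` and all points
`x + θ (x - x')` with `0 ≤ θ ≤ 1`, hence every extrapolated point of APG. -/
def extDom : Set (Vec n) := {u | ∃ x ∈ P.dom, ∃ x' ∈ P.dom, u = (2 : ℝ) • x - x'}

/-- Standing assumptions on the problem, together with the validity of the constants. -/
structure Assumptions (c : Params m) : Prop where
  g_smooth : LSmooth P.g c.L₀
  g_weak : WeaklyConvex P.g c.ρ₀
  rho_pos : 0 < c.ρ₀
  dom_compact : IsCompact P.dom
  h_convex : ConvexOn ℝ P.dom P.h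
  h_closed : LowerSemicontinuousOn P.h P.dom
  f_convex : ∀ i, ConvexOn ℝ Set.univ (P.f i)
  f_smooth : ∀ i, LSmooth (P.f i) (c.Lf i)
  f_bound : ∀ i, ∀ x ∈ P.extDom, max |P.f i x| ‖gradient (P.f i) x‖ ≤ c.Bf i
  beta_pos : 0 < c.β₀
  sigma_gt : 1 < c.σ
  w_pos : 0 < c.w₀

/-- The smooth part `φ = 𝓛_β(·, (y, z)) - h` of the augmented Lagrangian function. -/
noncomputable def alSmooth (β : ℝ) (y : Vec l) (z : Vec m) (x : Vec n) : ℝ :=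
  P.g x + ⟪y, P.A x - P.b⟫ + β / 2 * ‖P.A x - P.b‖ ^ 2
    + 1 / (2 * β) * (‖pos (z + β • P.fvec x)‖ ^ 2 - ‖z‖ ^ 2)

/-- `x` is an `ε`-KKT point: near primal feasibility (equalities and inequalities),
`dist(0, ∂f₀(x) + Aᵀ y + J_f(x)ᵀ z) ≤ ε` where `∂f₀ = ∇g + ∂h`, and near complementarity,
for some multipliers `y` and `z ≥ 0`. -/
def IsKKT (ε : ℝ) (x : Vec n) : Prop :=
  ∃ (y : Vec l) (z : Vec m),
    ‖P.A x - P.b‖ ≤ ε ∧ ‖pos (P.fvec x)‖ ≤ ε ∧ (∀ i, 0 ≤ z i) ∧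
    Metric.infEDist 0 ((fun s => gradient P.g x + s + P.A.adjoint y + P.jacT x z) ''
      subdiff P.dom P.h x) ≤ ENNReal.ofReal ε ∧
    ∑ i, |z i * P.f i x| ≤ ε

/-! ### The inexact augmented Lagrangian method -/

/-- The penalty parameter `β_k = β₀ σ^k`. -/
def beta (c : Params m) (k : ℕ) : ℝ := c.β₀ * c.σ ^ k

/-- The smoothness constant `L̂_k`, for the current multiplier `z = z^k`. -/
noncomputable def Lhat (c : Params m) (k : ℕ) (z : Vec m) : ℝ :=
  c.L₀ + beta c k * ‖P.A.adjoint ∘L P.A‖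
    + ∑ i, (beta c k * c.Bf i * (c.Bf i + c.Lf i) + c.Lf i * |z i|)

/-- `γ_k`, for the starting point `x0`. -/
noncomputable def gam (x0 : Vec n) (k : ℕ) : ℝ :=
  (Real.log 2) ^ 2 * min ‖P.A x0 - P.b‖ ‖pos (P.fvec x0)‖ / ((k + 1) * (Real.log (k + 2)) ^ 2)

/-- The dual step size `w_k`, for the new iterate `x = x^{k+1}`. When both residuals vanish the
quotient `γ_k / 0` is read as `+∞`. -/
noncomputable def wstep (c : Params m) (x0 : Vec n) (k : ℕ) (x : Vec n) : ℝ :=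
  let r := max ‖P.A x - P.b‖ ‖pos (P.fvec x)‖
  if r = 0 then c.w₀ * min 1 (beta c k / c.w₀)
  else c.w₀ * min (min 1 (P.gam x0 k / r)) (beta c k / c.w₀)

/-- State of the method: outer index `k`, multipliers `y^k`, `z^k`, the current iterate `center` of
the inexact proximal point method (iPPM), and the state of the APG call in progress. At the start
of outer iteration `k`, `center` is the outer iterate `x^k`. -/
structure State (n l m : ℕ) where
  k : ℕ
  y : Vec l
  z : Vec m
  center : Vec n
  apg : APGState n

/-- The smooth part `G = φ + ρ₀ ‖· - center‖²` of the iPPM subproblem. -/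
noncomputable def subG (c : Params m) (k : ℕ) (y : Vec l) (z : Vec m) (center x : Vec n) : ℝ :=
  P.alSmooth (beta c k) y z x + c.ρ₀ * ‖x - center‖ ^ 2

/-- Start a new call `APG(G, h, ρ₀, L̂_k + 2ρ₀, ε/4)` with `x̄^{-1} = xm`. -/
noncomputable def startCall (c : Params m) (k : ℕ) (y : Vec l) (z : Vec m) (center xm : Vec n) :
    State n l m :=
  ⟨k, y, z, center,
    apgInit P.dom P.h (P.subG c k y z center) (P.Lhat c k z + 2 * c.ρ₀) xm⟩

open Classical in
/-- One APG iteration of the whole method. If the APG test holds, the APG output `x` becomes the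
new iPPM iterate; if in addition `2ρ₀‖x - center‖ ≤ ε/2`, then iPPM returns `x^{k+1} = x`, the
multipliers are updated, and outer iteration `k + 1` begins. Whenever a new APG call begins, its
initial point `x̄^{-1}` is `xm`. -/
noncomputable def step (c : Params m) (ε : ℝ) (x0 xm : Vec n) (s : State n l m) : State n l m :=
  let G := P.subG c s.k s.y s.z s.center
  let a := apgStep P.dom P.h G c.ρ₀ (P.Lhat c s.k s.z + 2 * c.ρ₀) s.apg
  if apgTest P.dom P.h G (ε / 4) a.x then
    if 2 * c.ρ₀ * ‖a.x - s.center‖ ≤ ε / 2 then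
      let w := P.wstep c x0 s.k a.x
      P.startCall c (s.k + 1) (s.y + w • (P.A a.x - P.b))
        (WithLp.toLp 2 fun i => s.z i + w * max (-(s.z i / beta c s.k)) (P.f i a.x)) a.x xm
    else P.startCall c s.k s.y s.z a.x xm
  else { s with apg := a }

/-- The state after `N` APG iterations, with tolerance `ε`, starting point `x0`, and choices `xm`
of the initial points of the APG calls (`xm N` is used if a call begins after `N` iterations). -/
noncomputable def run (c : Params m) (ε : ℝ) (x0 : Vec n) (xm : ℕ → Vec n) : ℕ → State n l m
  | 0 => P.startCall c 0 0 0 x0 (xm 0)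
  | N + 1 => P.step c ε x0 (xm (N + 1)) (run c ε x0 xm N)

/-- The outer iterate `x^k` (`k ≥ 1`) equals `x` and is produced by the `N`-th APG iteration. -/
def Produces (s : ℕ → State n l m) (N k : ℕ) (x : Vec n) : Prop :=
  ∃ j, N = j + 1 ∧ (s j).k + 1 = k ∧ (s N).k = k ∧ (s N).center = x

/-- The generalized regularity condition with constant `v` along the outer iterates `x^k`, `k ≥ 1`,
of the run `s`. -/
def Regular (c : Params m) (v : ℝ) (s : ℕ → State n l m) : Prop :=
  ∀ N k x, Produces s N k x →
    ENNReal.ofReal (v * √(‖P.A x - P.b‖ ^ 2 + ‖pos (P.fvec x)‖ ^ 2)) ≤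
      Metric.infEDist (-(P.A.adjoint (P.A x - P.b)) - P.jacT x (pos (P.fvec x)))
        ((beta c (k - 1))⁻¹ • subdiff P.dom P.h x)

end Problem

end IALM

/-! The iteration count is a product of three factors: O(log(1/ε)) outer iterations, Õ(ε^{-2})
proximal point steps in each of them, and Õ(ε^{-1/2}) APG iterations in each such step.

Everything rests on bounds at the outer iterates that are polynomial in k and free of β_k. From the
dual steps only 0 ≤ w_k ≤ min(w₀, β_k) is used: it keeps z^k ≥ 0 and lets ‖y^k‖, ‖z^k‖ grow at most
linearly in k. Stationarity of the augmented Lagrangian at x^{k+1} says that β_k times the vector in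
the regularity condition lies within ε + O(1 + ‖y^k‖ + ‖z^k‖) of ∂h. Regularity therefore gives β_k
· residual(x^{k+1}) = O(k+1) (`residual_le_of_regular`). Hence the penalty terms at x^k are
O((k+1)²) although β_k grows geometrically. Since h need not be bounded above on its domain, the
objective value is carried along as well: inexact descent raises it by O((k+1)²) per outer
iteration. `OuterInvariant` collects these bounds and `OuterInvariant.next` propagates them;
`gap_le` then shows that each proximal point call starts O((k+1)³) above a lower bound of its
objective.

The convex constraints enter through convex penalties, so the weak convexity modulus stays ρ₀ for
every β (`alSmooth_first_order`). A proximal point step that does not end the call decreases the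
objective by at least ε²/(96ρ₀), so the gap limits the number of steps (`run_prox`). Each subproblem
is ρ₀-strongly convex with smoothness constant O((k+1)β_k), and APG solves it in √(L/ρ₀) · log
iterations by contraction of a potential (`potential_step`, `exists_apgTest`).

With multipliers y + β(Ax - b) and [z + βf]_+, a stationary point of the augmented Lagrangian is KKT
with feasibility and complementarity errors O((k+1)²/β_k) (`isKKT_of_stationary`). The first K with
β_K ≥ const · (K+1)²/ε thus suffices; K is logarithmic and β_K = Õ(1/ε) (`exists_outer_index`).
Multiplying the three counts gives the claim. -/

namespace IALM

/-! ### Proximal gradient steps and linear convergence of APG. -/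

section Analysis

variable {n : ℕ}

theorem hasDerivAt_along_line {φ : Vec n → ℝ} (hφ : Differentiable ℝ φ) (x d : Vec n) (t : ℝ) :
    HasDerivAt (fun t : ℝ => φ (x + t • d)) ⟪gradient φ (x + t • d), d⟫ t := by
  have h1 : HasDerivAt (fun t : ℝ => x + t • d) d t := by
    simpa using ((hasDerivAt_id t).smul_const d).const_add x
  exact ((hφ (x + t • d)).hasGradientAt.hasFDerivAt).comp_hasDerivAt t h1

/-- First-order characterization of convexity. -/
theorem ConvexOn.gradient_le {φ : Vec n → ℝ} (hc : ConvexOn ℝ Set.univ φ)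
    (hφ : Differentiable ℝ φ) (x u : Vec n) : φ x + ⟪gradient φ x, u - x⟫ ≤ φ u := by
  have hline : ConvexOn ℝ Set.univ (fun t : ℝ => φ (x + t • (u - x))) := by
    refine ⟨convex_univ, fun s _ t _ a b ha hb hab => ?_⟩
    have h := hc.2 (Set.mem_univ (x + s • (u - x))) (Set.mem_univ (x + t • (u - x))) ha hb hab
    have e : x + (a • s + b • t) • (u - x)
        = a • (x + s • (u - x)) + b • (x + t • (u - x)) := by
      have : x = (a + b) • x := by rw [hab, one_smul]
      nth_rewrite 1 [this]
      simp only [smul_eq_mul]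
      module
    simp only [e]
    exact h
  have h := hline.le_slope_of_hasDerivAt (Set.mem_univ 0) (Set.mem_univ 1) one_pos
    (hasDerivAt_along_line hφ x (u - x) 0)
  simp only [slope_def_field, zero_smul, add_zero, one_smul, sub_zero, div_one,
    add_sub_cancel] at h
  linarith

/-- The quadratic upper bound for a function whose gradient is Lipschitz on a convex set. -/
theorem le_quadratic_of_lipschitz_gradient {G : Vec n → ℝ} (hG : Differentiable ℝ G)
    {S : Set (Vec n)} (hS : Convex ℝ S) {L : ℝ}
    (hL : ∀ x ∈ S, ∀ y ∈ S, ‖gradient G x - gradient G y‖ ≤ L * ‖x - y‖)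
    {x y : Vec n} (hx : x ∈ S) (hy : y ∈ S) :
    G x ≤ G y + ⟪gradient G y, x - y⟫ + L / 2 * ‖x - y‖ ^ 2 := by
  set d := x - y with hd
  let ψ : ℝ → ℝ := fun t => G (y + t • d) - t * ⟪gradient G y, d⟫ - L / 2 * ‖d‖ ^ 2 * t ^ 2
  have hder : ∀ t : ℝ, HasDerivAt ψ
      (⟪gradient G (y + t • d), d⟫ - ⟪gradient G y, d⟫ - L * ‖d‖ ^ 2 * t) t := by
    intro t
    have h1 := hasDerivAt_along_line hG y d t
    have h2 := (hasDerivAt_id t).mul_const ⟪gradient G y, d⟫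
    have h3 := (hasDerivAt_pow 2 t).const_mul (L / 2 * ‖d‖ ^ 2)
    refine ((h1.sub h2).sub h3).congr_deriv ?_
    push_cast
    ring
  have hanti : AntitoneOn ψ (Set.Icc 0 1) := by
    refine antitoneOn_of_deriv_nonpos (convex_Icc 0 1)
      (fun t _ => (hder t).continuousAt.continuousWithinAt)
      (fun t _ => (hder t).differentiableAt.differentiableWithinAt) fun t ht => ?_
    rw [interior_Icc] at ht
    rw [(hder t).deriv]
    have hmem : y + t • d ∈ S := by
      have := hS hy hx (sub_nonneg.2 ht.2.le) ht.1.le (by ring)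
      convert this using 1
      rw [hd]; module
    have h1 := hL _ hmem _ hy
    have h2 : ⟪gradient G (y + t • d) - gradient G y, d⟫ ≤ L * (t * ‖d‖) * ‖d‖ := by
      refine (real_inner_le_norm _ _).trans (mul_le_mul_of_nonneg_right ?_ (norm_nonneg _))
      simpa [norm_smul, abs_of_pos ht.1] using h1
    rw [inner_sub_left] at h2
    nlinarith
  have h := hanti (Set.left_mem_Icc.2 zero_le_one) (Set.right_mem_Icc.2 zero_le_one) zero_le_one
  simp only [ψ, one_smul, zero_smul, add_zero] at h
  have e : y + d = x := by rw [hd]; abel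
  rw [e] at h
  linarith

/-- Replaces directional derivatives: a minimizer is compared with points at parameter t on a
segment, the inequality is divided by t, and t tends to 0. -/
theorem nonneg_of_forall_add_mul_nonneg {a b : ℝ}
    (h : ∀ t : ℝ, 0 < t → t ≤ 1 → 0 ≤ a + t * b) : 0 ≤ a := by
  have hlim : Filter.Tendsto (fun t : ℝ => a + t * b) (nhdsWithin 0 (Set.Ioi 0)) (nhds a) := by
    have : Filter.Tendsto (fun t : ℝ => a + t * b) (nhds 0) (nhds (a + 0 * b)) :=
      (Continuous.tendsto (by fun_prop) 0)
    simp only [zero_mul, add_zero] at this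
    exact this.mono_left nhdsWithin_le_nhds
  refine ge_of_tendsto hlim ?_
  filter_upwards [Ioc_mem_nhdsGT (zero_lt_one' ℝ)] with t ht using h t ht.1 ht.2

/-- First-order optimality for a proximal subproblem. -/
theorem IsMinOn.neg_sub_mem_subdiff {D : Set (Vec n)} {H : Vec n → ℝ} (hH : ConvexOn ℝ D H)
    {a y p : Vec n} {L : ℝ} (hp : p ∈ D)
    (hmin : IsMinOn (fun u => ⟪a, u⟫ + L / 2 * ‖u - y‖ ^ 2 + H u) D p) :
    -a - L • (p - y) ∈ subdiff D H p := by
  refine ⟨hp, fun u hu => ?_⟩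
  suffices h : 0 ≤ H u - H p + ⟪a, u - p⟫ + L * ⟪p - y, u - p⟫ by
    rw [inner_sub_left, inner_neg_left, inner_smul_left]
    simp only [conj_trivial]
    linarith
  refine nonneg_of_forall_add_mul_nonneg (b := L / 2 * ‖u - p‖ ^ 2) fun t ht ht1 => ?_
  have hq : (1 - t) • p + t • u ∈ D := hH.1 hp hu (sub_nonneg.2 ht1) ht.le (by ring)
  have h1 := hH.2 hp hu (sub_nonneg.2 ht1) ht.le (by ring)
  have h2 := isMinOn_iff.1 hmin _ hq
  have e1 : (1 - t) • p + t • u = p + t • (u - p) := by module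
  have e2 : (1 - t) • p + t • u - y = (p - y) + t • (u - p) := by module
  have e3 : ‖(p - y) + t • (u - p)‖ ^ 2
      = ‖p - y‖ ^ 2 + 2 * t * ⟪p - y, u - p⟫ + t ^ 2 * ‖u - p‖ ^ 2 := by
    rw [norm_add_sq_real, inner_smul_right, norm_smul, Real.norm_of_nonneg ht.le]
    ring
  simp only [e2, e3] at h2
  rw [e1] at h1 h2
  rw [inner_add_right, inner_smul_right] at h2
  simp only [smul_eq_mul] at h1
  have h3 : 0 ≤ t * (H u - H p + ⟪a, u - p⟫ + L * ⟪p - y, u - p⟫ + t * (L / 2 * ‖u - p‖ ^ 2)) := by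
    nlinarith
  exact nonneg_of_mul_nonneg_right h3 ht

/-- The points `2x - x'` with `x, x' ∈ D`. -/
def extrapolationSet (D : Set (Vec n)) : Set (Vec n) :=
  {u | ∃ x ∈ D, ∃ x' ∈ D, u = (2 : ℝ) • x - x'}

theorem Convex.extrapolationSet {D : Set (Vec n)} (hD : Convex ℝ D) :
    Convex ℝ (extrapolationSet D) := by
  rintro _ ⟨x, hx, x', hx', rfl⟩ _ ⟨y, hy, y', hy', rfl⟩ a b ha hb hab
  exact ⟨_, hD hx hy ha hb hab, _, hD hx' hy' ha hb hab, by module⟩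

theorem extrapolate_mem {D : Set (Vec n)} (hD : Convex ℝ D) {x x' : Vec n} (hx : x ∈ D)
    (hx' : x' ∈ D) {θ : ℝ} (h0 : 0 ≤ θ) (h1 : θ ≤ 1) :
    x + θ • (x - x') ∈ extrapolationSet D :=
  ⟨x, hx, _, hD hx hx' (sub_nonneg.2 h1) h0 (by ring), by module⟩

theorem subset_extrapolationSet (D : Set (Vec n)) : D ⊆ extrapolationSet D :=
  fun x hx => ⟨x, hx, x, hx, by module⟩

/-- The composite model `min G + H` over `D`, with `G` strongly convex with modulus `μ` and with
`L`-Lipschitz gradient at all points that the accelerated method visits. -/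
structure CompositeModel (D : Set (Vec n)) (H G : Vec n → ℝ) (μ L : ℝ) : Prop where
  compact : IsCompact D
  convex : ConvexOn ℝ D H
  closed : LowerSemicontinuousOn H D
  diff : Differentiable ℝ G
  strong : ∀ x u, G x + ⟪gradient G x, u - x⟫ + μ / 2 * ‖u - x‖ ^ 2 ≤ G u
  lip : ∀ x ∈ extrapolationSet D, ∀ y ∈ extrapolationSet D,
    ‖gradient G x - gradient G y‖ ≤ L * ‖x - y‖
  mu_pos : 0 < μ
  mu_le : μ ≤ L

namespace CompositeModel

variable {D : Set (Vec n)} {H G : Vec n → ℝ} {μ L : ℝ}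

theorem proxGrad_spec (M : CompositeModel D H G μ L) (hne : D.Nonempty) (y : Vec n) :
    proxGrad D H G L y ∈ D ∧ IsMinOn
      (fun u => ⟪gradient G y, u⟫ + L / 2 * ‖u - y‖ ^ 2 + H u) D (proxGrad D H G L y) := by
  have hlsc : LowerSemicontinuousOn
      (fun u => ⟪gradient G y, u⟫ + L / 2 * ‖u - y‖ ^ 2 + H u) D := by
    refine LowerSemicontinuousOn.add ((Continuous.lowerSemicontinuous ?_).lowerSemicontinuousOn _)
      M.closed
    fun_prop
  obtain ⟨p, hp, hmin⟩ := hlsc.exists_isMinOn hne M.compact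
  exact Classical.epsilon_spec (p := fun x => x ∈ D ∧ IsMinOn
      (fun u => ⟪gradient G y, u⟫ + L / 2 * ‖u - y‖ ^ 2 + H u) D x) ⟨p, hp, hmin⟩

theorem proxGrad_mem (M : CompositeModel D H G μ L) (hne : D.Nonempty) (y : Vec n) :
    proxGrad D H G L y ∈ D := (M.proxGrad_spec hne y).1

theorem proxGrad_subgradient (M : CompositeModel D H G μ L) (hne : D.Nonempty) (y : Vec n) :
    -gradient G y - L • (proxGrad D H G L y - y) ∈ subdiff D H (proxGrad D H G L y) :=
  IsMinOn.neg_sub_mem_subdiff M.convex (M.proxGrad_mem hne y) (M.proxGrad_spec hne y).2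

/-- The fundamental inequality of a proximal gradient step. -/
theorem proxGrad_le (M : CompositeModel D H G μ L) {y u : Vec n}
    (hy : y ∈ extrapolationSet D) (hu : u ∈ D) :
    G (proxGrad D H G L y) + H (proxGrad D H G L y) + L / 2 * ‖u - proxGrad D H G L y‖ ^ 2
      ≤ G u + H u + (L - μ) / 2 * ‖u - y‖ ^ 2 := by
  have hp := M.proxGrad_mem ⟨u, hu⟩ y
  have hs := (M.proxGrad_subgradient ⟨u, hu⟩ y).2 u hu
  set p := proxGrad D H G L y
  have h1 := le_quadratic_of_lipschitz_gradient M.diff (Convex.extrapolationSet M.convex.1) M.lip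
    (subset_extrapolationSet D hp) hy
  have h2 := M.strong y u
  have e1 : ⟪gradient G y, u - y⟫ = ⟪gradient G y, u - p⟫ + ⟪gradient G y, p - y⟫ := by
    rw [← inner_add_right]; congr 1; abel
  have e2 : ‖u - y‖ ^ 2 = ‖u - p‖ ^ 2 + 2 * ⟪p - y, u - p⟫ + ‖p - y‖ ^ 2 := by
    have : u - y = (u - p) + (p - y) := by abel
    rw [this, norm_add_sq_real, real_inner_comm]
  rw [inner_sub_left, inner_neg_left, inner_smul_left] at hs
  simp only [conj_trivial] at hs
  rw [e1] at h2
  have e3 := congrArg (fun r => L / 2 * r) e2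
  linarith

/-- Lower semicontinuity on the compact domain gives existence; strong convexity of `G` gives the
quadratic growth, which later turns small function gaps into small distances. -/
theorem exists_minimizer (M : CompositeModel D H G μ L) (hne : D.Nonempty) :
    ∃ x ∈ D, ∀ u ∈ D, G x + H x + μ / 2 * ‖u - x‖ ^ 2 ≤ G u + H u := by
  have hlsc : LowerSemicontinuousOn (fun u => G u + H u) D :=
    LowerSemicontinuousOn.add (M.diff.continuous.lowerSemicontinuous.lowerSemicontinuousOn _)
      M.closed
  obtain ⟨p, hp, hmin⟩ := hlsc.exists_isMinOn hne M.compact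
  refine ⟨p, hp, fun u hu => ?_⟩
  suffices h : 0 ≤ G u + H u - (G p + H p) - μ / 2 * ‖u - p‖ ^ 2 by linarith
  refine nonneg_of_forall_add_mul_nonneg (b := μ / 2 * ‖u - p‖ ^ 2) fun t ht ht1 => ?_
  have hq : (1 - t) • p + t • u ∈ D := M.convex.1 hp hu (sub_nonneg.2 ht1) ht.le (by ring)
  have h1 := M.convex.2 hp hu (sub_nonneg.2 ht1) ht.le (by ring)
  have h2 := isMinOn_iff.1 hmin _ hq
  set q := (1 - t) • p + t • u with hqdef
  have h3 := M.strong q p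
  have h4 := M.strong q u
  have e1 : p - q = (-t) • (u - p) := by rw [hqdef]; module
  have e2 : u - q = (1 - t) • (u - p) := by rw [hqdef]; module
  rw [e1, inner_smul_right, norm_smul, mul_pow, Real.norm_eq_abs, sq_abs] at h3
  rw [e2, inner_smul_right, norm_smul, mul_pow, Real.norm_eq_abs, sq_abs] at h4
  simp only [smul_eq_mul] at h1
  have h5 := mul_le_mul_of_nonneg_left h3 (sub_nonneg.2 ht1)
  have h6 := mul_le_mul_of_nonneg_left h4 ht.le
  have h7 : 0 ≤ t * (G u + H u - (G p + H p) - μ / 2 * ‖u - p‖ ^ 2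
      + t * (μ / 2 * ‖u - p‖ ^ 2)) := by nlinarith
  exact nonneg_of_mul_nonneg_right h7 ht

/-- One accelerated step contracts the potential `F(x) - F(x*) + (μ/2)‖v - x*‖²`. -/
theorem potential_step (M : CompositeModel D H G μ L) {α : ℝ} (hα0 : 0 < α) (hα1 : α ≤ 1)
    (hα : L * α ^ 2 = μ) {x v s : Vec n} (hx : x ∈ D) (hs : s ∈ D)
    (hy : (1 + α)⁻¹ • (x + α • v) ∈ extrapolationSet D) :
    let p := proxGrad D H G L ((1 + α)⁻¹ • (x + α • v))
    G p + H p - (G s + H s) + μ / 2 * ‖x + α⁻¹ • (p - x) - s‖ ^ 2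
      ≤ (1 - α) * (G x + H x - (G s + H s) + μ / 2 * ‖v - s‖ ^ 2) := by
  intro p
  have hα1' : 0 ≤ 1 - α := sub_nonneg.2 hα1
  -- The proximal inequality is tested at this convex combination. The new `v` is the point that
  -- makes `u - p` equal to -α(v - s), so that L‖u - p‖² becomes μ‖v - s‖².
  have hu : (1 - α) • x + α • s ∈ D := M.convex.1 hx hs hα1' hα0.le (by ring)
  have h1 := M.proxGrad_le hy hu
  have h2 := M.convex.2 hx hs hα1' hα0.le (by ring)
  set y := (1 + α)⁻¹ • (x + α • v) with hydef
  set u := (1 - α) • x + α • s with hudef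
  have hp : proxGrad D H G L y = p := rfl
  rw [hp] at h1
  have h3 := M.strong u x
  have h4 := M.strong u s
  have e1 : x - u = (-α) • (s - x) := by rw [hudef]; module
  have e2 : s - u = (1 - α) • (s - x) := by rw [hudef]; module
  rw [e1, inner_smul_right, norm_smul, mul_pow, Real.norm_eq_abs, sq_abs] at h3
  rw [e2, inner_smul_right, norm_smul, mul_pow, Real.norm_eq_abs, sq_abs] at h4
  simp only [smul_eq_mul] at h2
  have h5 := mul_le_mul_of_nonneg_left h3 hα1'
  have h6 := mul_le_mul_of_nonneg_left h4 hα0.le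
  have e3 : u - p = (-α) • (x + α⁻¹ • (p - x) - s) := by
    have : α • (α⁻¹ • (p - x)) = p - x := by rw [smul_smul, mul_inv_cancel₀ hα0.ne', one_smul]
    rw [smul_sub, smul_add, neg_smul, neg_smul, this, hudef]; module
  have e3' : L * ‖u - p‖ ^ 2 = μ * ‖x + α⁻¹ • (p - x) - s‖ ^ 2 := by
    rw [e3, norm_smul, mul_pow, Real.norm_eq_abs, sq_abs, neg_sq, ← mul_assoc, hα]
  have hpos : 0 < 1 + α := by linarith
  have e4 : (1 + α) • (u - y) = (-α) • ((v - s) + α • (x - s)) := by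
    rw [smul_sub, hydef, smul_smul, mul_inv_cancel₀ hpos.ne', one_smul, hudef]; module
  have e5 : (1 + α) ^ 2 * ‖u - y‖ ^ 2 = α ^ 2 * ‖(v - s) + α • (x - s)‖ ^ 2 := by
    have := congrArg (fun w : Vec n => ‖w‖ ^ 2) e4
    simpa only [norm_smul, mul_pow, Real.norm_eq_abs, sq_abs, neg_sq] using this
  -- Convexity of the squared norm with weights 1 and α. The extra ‖x - s‖² term is cancelled
  -- exactly by the strong convexity slack in `h5` and `h6`, because L - μ = L(1 - α)(1 + α).
  have h7 : ‖(v - s) + α • (x - s)‖ ^ 2 ≤ (1 + α) * (‖v - s‖ ^ 2 + α * ‖x - s‖ ^ 2) := by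
    rw [norm_add_sq_real, norm_smul, mul_pow, Real.norm_eq_abs, sq_abs, inner_smul_right]
    have h8 := norm_sub_sq_real (v - s) (x - s)
    have h9 := mul_nonneg hα0.le (sq_nonneg ‖(v - s) - (x - s)‖)
    rw [h8] at h9
    linarith
  have h8 : (1 + α) * ‖u - y‖ ^ 2 ≤ α ^ 2 * (‖v - s‖ ^ 2 + α * ‖x - s‖ ^ 2) := by
    have : (1 + α) * ((1 + α) * ‖u - y‖ ^ 2)
        ≤ (1 + α) * (α ^ 2 * (‖v - s‖ ^ 2 + α * ‖x - s‖ ^ 2)) := by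
      linarith [mul_le_mul_of_nonneg_left h7 (sq_nonneg α)]
    exact le_of_mul_le_mul_left this hpos
  have hL : 0 < L := M.mu_pos.trans_le M.mu_le
  have h9 : (L - μ) / 2 * ‖u - y‖ ^ 2
      ≤ μ / 2 * (1 - α) * (‖v - s‖ ^ 2 + α * ‖x - s‖ ^ 2) := by
    have := mul_le_mul_of_nonneg_left h8 (mul_nonneg (half_pos hL).le hα1')
    rw [← hα]
    linarith
  have e6 : ‖s - x‖ = ‖x - s‖ := norm_sub_rev _ _
  rw [e6] at h5 h6
  linarith

/-- The states of an APG call started from `xm`. -/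
noncomputable def _root_.IALM.apgIter (D : Set (Vec n)) (H G : Vec n → ℝ) (μ L : ℝ) (xm : Vec n) :
    ℕ → APGState n
  | 0 => apgInit D H G L xm
  | t + 1 => apgStep D H G μ L (apgIter D H G μ L xm t)

theorem L_pos (M : CompositeModel D H G μ L) : 0 < L := M.mu_pos.trans_le M.mu_le

theorem sqrt_pos (M : CompositeModel D H G μ L) : 0 < √(μ / L) :=
  Real.sqrt_pos.2 (div_pos M.mu_pos M.L_pos)

theorem sqrt_le_one (M : CompositeModel D H G μ L) : √(μ / L) ≤ 1 :=
  Real.sqrt_le_one.2 ((div_le_one M.L_pos).2 M.mu_le)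

theorem mul_sqrt_sq (M : CompositeModel D H G μ L) : L * √(μ / L) ^ 2 = μ := by
  rw [Real.sq_sqrt (div_pos M.mu_pos M.L_pos).le, mul_div_cancel₀ _ M.L_pos.ne']

/-- The auxiliary point `v` is never computed by the algorithm; the extrapolation coefficient (1 -
α)/(1 + α) is the one for which x̄ = (x + αv)/(1 + α) persists. That coefficient lies in [0, 1], so
x̄ stays where the gradient is known to be Lipschitz. -/
theorem apgIter_invariant (M : CompositeModel D H G μ L) {Dm : ℝ}
    (hDm : ∀ x ∈ D, ∀ y ∈ D, ‖x - y‖ ≤ Dm) {xm s : Vec n} (hxm : xm ∈ D) (hs : s ∈ D) (t : ℕ) :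
    (apgIter D H G μ L xm t).x ∈ D ∧
    (apgIter D H G μ L xm t).xbar ∈ extrapolationSet D ∧
    ∃ v, (apgIter D H G μ L xm t).xbar
        = (1 + √(μ / L))⁻¹ • ((apgIter D H G μ L xm t).x + √(μ / L) • v) ∧
      G (apgIter D H G μ L xm t).x + H (apgIter D H G μ L xm t).x - (G s + H s)
        + μ / 2 * ‖v - s‖ ^ 2 ≤ (1 - √(μ / L)) ^ t * (L / 2 * Dm ^ 2) := by
  have h0 := M.sqrt_pos
  have h1 := M.sqrt_le_one
  have h2 := M.mul_sqrt_sq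
  set α := √(μ / L) with hα
  have hpos : 0 < 1 + α := by linarith
  induction t with
  | zero =>
    have hp : (apgIter D H G μ L xm 0).x ∈ D := M.proxGrad_mem ⟨s, hs⟩ xm
    refine ⟨hp, subset_extrapolationSet D hp, (apgIter D H G μ L xm 0).x, ?_, ?_⟩
    · have : ∀ w : Vec n, w = (1 + α)⁻¹ • (w + α • w) := fun w => by
        have : w + α • w = (1 + α) • w := by module
        rw [this, smul_smul, inv_mul_cancel₀ hpos.ne', one_smul]
      exact this _
    · have h3 := M.proxGrad_le (subset_extrapolationSet D hxm) hs
      have h4 : ‖s - xm‖ ^ 2 ≤ Dm ^ 2 := pow_le_pow_left₀ (norm_nonneg _) (hDm s hs xm hxm) 2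
      change G (proxGrad D H G L xm) + H (proxGrad D H G L xm) - (G s + H s)
        + μ / 2 * ‖proxGrad D H G L xm - s‖ ^ 2 ≤ _
      rw [norm_sub_rev]
      have h5 := M.mu_le
      have h6 := M.mu_pos
      have h7 := mul_le_mul_of_nonneg_right h5 (sq_nonneg ‖s - proxGrad D H G L xm‖)
      have h8 := mul_le_mul_of_nonneg_left h4 (sub_nonneg.2 h5)
      have h9 := mul_nonneg h6.le (sq_nonneg Dm)
      rw [pow_zero, one_mul]
      linarith
  | succ t ih =>
    obtain ⟨hx, hxb, v, hv, hE⟩ := ih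
    set a := apgIter D H G μ L xm t
    have hp : proxGrad D H G L a.xbar ∈ D := M.proxGrad_mem ⟨s, hs⟩ a.xbar
    have e1 : (apgIter D H G μ L xm (t + 1)).x = proxGrad D H G L a.xbar := rfl
    have e2 : (apgIter D H G μ L xm (t + 1)).xbar = proxGrad D H G L a.xbar
      + ((1 - α) / (1 + α)) • (proxGrad D H G L a.xbar - a.x) := rfl
    rw [e1, e2]
    refine ⟨hp, extrapolate_mem M.convex.1 hp hx (div_nonneg (sub_nonneg.2 h1) hpos.le)
      ((div_le_one hpos).2 (by linarith)), a.x + α⁻¹ • (proxGrad D H G L a.xbar - a.x), ?_, ?_⟩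
    · rw [smul_add α, smul_smul α, mul_inv_cancel₀ h0.ne', one_smul]
      have : ((1 - α) / (1 + α)) = (1 + α)⁻¹ * (1 - α) := by ring
      have h3 : proxGrad D H G L a.xbar
          = (1 + α)⁻¹ • ((1 + α) • proxGrad D H G L a.xbar) := by
        rw [smul_smul, inv_mul_cancel₀ hpos.ne', one_smul]
      nth_rewrite 1 [this, mul_smul, h3]
      rw [← smul_add]
      congr 1
      module
    · have h3 := M.potential_step h0 h1 h2 hx hs (by rw [← hv]; exact hxb)
      simp only [← hv] at h3
      refine h3.trans ?_
      rw [pow_succ' (1 - α), mul_assoc]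
      exact mul_le_mul_of_nonneg_left hE (sub_nonneg.2 h1)

/-- Optimality of the last proximal step supplies the subgradient -∇G(x̄) - L(p - x̄), so the tested
distance is at most 2L‖p - x̄‖. Both p and x̄ are within √(2B/μ) of the minimizer, where B bounds
the potential. -/
theorem apgTest_of_pow_le (M : CompositeModel D H G μ L) {Dm : ℝ}
    (hDm : ∀ x ∈ D, ∀ y ∈ D, ‖x - y‖ ≤ Dm) {xm : Vec n} (hxm : xm ∈ D) {δ : ℝ} (hδ : 0 ≤ δ)
    (t : ℕ) (ht : 16 * L ^ 3 * Dm ^ 2 * (1 - √(μ / L)) ^ t ≤ μ * δ ^ 2) :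
    apgTest D H G δ (apgIter D H G μ L xm (t + 1)).x := by
  obtain ⟨s, hs, hmin⟩ := M.exists_minimizer ⟨xm, hxm⟩
  obtain ⟨hx, hxb, v, hv, hE⟩ := M.apgIter_invariant hDm hxm hs t
  obtain ⟨hx', -, v', -, hE'⟩ := M.apgIter_invariant hDm hxm hs (t + 1)
  have e1 : (apgIter D H G μ L xm (t + 1)).x
    = proxGrad D H G L (apgIter D H G μ L xm t).xbar := rfl
  have hsub := M.proxGrad_subgradient ⟨s, hs⟩ (apgIter D H G μ L xm t).xbar
  rw [← e1] at hsub
  set a := apgIter D H G μ L xm t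
  set p := (apgIter D H G μ L xm (t + 1)).x
  have h0 := M.sqrt_pos
  have h1 := M.sqrt_le_one
  have hμ := M.mu_pos
  have hL := M.L_pos
  set α := √(μ / L)
  have hpos : 0 < 1 + α := by linarith
  set B := (1 - α) ^ t * (L / 2 * Dm ^ 2) with hB
  have hB0 : 0 ≤ B := mul_nonneg (pow_nonneg (sub_nonneg.2 h1) _) (by positivity)
  have hB' : (1 - α) ^ (t + 1) * (L / 2 * Dm ^ 2) ≤ B := by
    rw [pow_succ', mul_assoc]
    exact mul_le_of_le_one_left hB0 (by linarith)
  have key : ∀ w : Vec n, μ / 2 * ‖w - s‖ ^ 2 ≤ B → ‖w - s‖ ≤ √(2 * B / μ) := by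
    intro w hw
    refine Real.le_sqrt_of_sq_le ?_
    rw [le_div_iff₀ hμ]
    linarith
  have k1 : ‖p - s‖ ≤ √(2 * B / μ) := by
    refine key p ?_
    have := hmin p hx'
    have := mul_nonneg hμ.le (sq_nonneg ‖v' - s‖)
    linarith
  have k2 : ‖a.x - s‖ ≤ √(2 * B / μ) := by
    refine key a.x ?_
    have := hmin a.x hx
    have := mul_nonneg hμ.le (sq_nonneg ‖v - s‖)
    linarith
  have k3 : ‖v - s‖ ≤ √(2 * B / μ) := by
    refine key v ?_
    have := hmin a.x hx
    have := mul_nonneg hμ.le (sq_nonneg ‖a.x - s‖)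
    linarith
  set r := √(2 * B / μ) with hr
  have k4 : ‖a.xbar - s‖ ≤ r := by
    have e : a.xbar - s = (1 + α)⁻¹ • ((a.x - s) + α • (v - s)) := by
      have : s = (1 + α)⁻¹ • ((1 + α) • s) := by
        rw [smul_smul, inv_mul_cancel₀ hpos.ne', one_smul]
      nth_rewrite 1 [hv, this]
      rw [← smul_sub]
      congr 1
      module
    rw [e, norm_smul, Real.norm_of_nonneg (inv_nonneg.2 hpos.le), inv_mul_le_iff₀ hpos]
    refine (norm_add_le _ _).trans ?_
    rw [norm_smul, Real.norm_of_nonneg h0.le]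
    nlinarith
  have k5 : ‖p - a.xbar‖ ≤ 2 * r := by
    have e : p - a.xbar = (p - s) - (a.xbar - s) := by abel
    rw [e]
    exact (norm_sub_le _ _).trans (by linarith)
  -- Squaring gives 16L² · 2B/μ with 2B = L · Dm² · (1 - α)^t, whence the constant 16L³ in the
  -- hypothesis.
  have k6 : 4 * L * r ≤ δ := by
    refine le_of_sq_le_sq ?_ hδ
    rw [mul_pow, hr, Real.sq_sqrt (by positivity), hB, ← mul_le_mul_iff_right₀ hμ]
    refine le_trans (le_of_eq ?_) ht
    field_simp
    ring
  refine (Metric.infEDist_le_edist_of_mem hsub).trans ?_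
  rw [edist_dist, dist_eq_norm]
  refine ENNReal.ofReal_le_ofReal ?_
  have e : -gradient G p - (-gradient G a.xbar - L • (p - a.xbar))
      = L • (p - a.xbar) - (gradient G p - gradient G a.xbar) := by abel
  rw [e]
  refine (norm_sub_le _ _).trans ?_
  have := M.lip p (subset_extrapolationSet D hx') a.xbar hxb
  rw [norm_smul, Real.norm_of_nonneg hL.le]
  have := mul_le_mul_of_nonneg_left k5 hL.le
  linarith

/-- Iteration complexity of an APG call. -/
theorem exists_apgTest (M : CompositeModel D H G μ L) {Dm : ℝ}
    (hDm : ∀ x ∈ D, ∀ y ∈ D, ‖x - y‖ ≤ Dm) {xm : Vec n} (hxm : xm ∈ D) {δ Q : ℝ} (hδ : 0 ≤ δ)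
    (hQ1 : 1 ≤ Q) (hQ : 16 * L ^ 3 * Dm ^ 2 ≤ μ * δ ^ 2 * Q) :
    ∃ t : ℕ, (t : ℝ) ≤ √(L / μ) * Real.log Q + 1 ∧
      apgTest D H G δ (apgIter D H G μ L xm (t + 1)).x := by
  have h0 := M.sqrt_pos
  have h1 := M.sqrt_le_one
  have hμ := M.mu_pos
  have hinv : √(L / μ) = (√(μ / L))⁻¹ := by rw [← Real.sqrt_inv, inv_div]
  rw [hinv]
  have hlog := Real.log_nonneg hQ1
  refine ⟨⌈(√(μ / L))⁻¹ * Real.log Q⌉₊,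
    (Nat.ceil_lt_add_one (mul_nonneg (inv_nonneg.2 h0.le) hlog)).le,
    M.apgTest_of_pow_le hDm hxm hδ _ ?_⟩
  have hceil := Nat.le_ceil ((√(μ / L))⁻¹ * Real.log Q)
  set t := ⌈(√(μ / L))⁻¹ * Real.log Q⌉₊
  set α := √(μ / L)
  have hpow : (1 - α) ^ t ≤ Q⁻¹ := by
    have h3 : (1 - α) ^ t ≤ Real.exp (-α) ^ t :=
      pow_le_pow_left₀ (sub_nonneg.2 h1) (by linarith [Real.add_one_le_exp (-α)]) t
    refine h3.trans ?_
    rw [← Real.exp_nat_mul, ← Real.exp_log (zero_lt_one.trans_le hQ1), ← Real.exp_neg]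
    refine Real.exp_le_exp.2 ?_
    rw [inv_mul_le_iff₀ h0] at hceil
    linarith
  have hL := M.L_pos
  have hQ0 : 0 < Q := zero_lt_one.trans_le hQ1
  calc 16 * L ^ 3 * Dm ^ 2 * (1 - α) ^ t ≤ 16 * L ^ 3 * Dm ^ 2 * Q⁻¹ :=
        mul_le_mul_of_nonneg_left hpow (by positivity)
    _ ≤ μ * δ ^ 2 * Q * Q⁻¹ := mul_le_mul_of_nonneg_right hQ (inv_nonneg.2 hQ0.le)
    _ = μ * δ ^ 2 := mul_inv_cancel_right₀ hQ0.ne' _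

end CompositeModel

end Analysis

end IALM

/-! ### Gradient, weak convexity and smoothness of the augmented Lagrangian. -/

namespace IALM

section Gradients

/-- The first-order remainder is at most (x - s)² in absolute value, also across the kink of the
positive part. -/
theorem hasDerivAt_max_zero_sq (s : ℝ) :
    HasDerivAt (fun s : ℝ => max s 0 ^ 2) (2 * max s 0) s := by
  rw [hasDerivAt_iff_isLittleO]
  refine Asymptotics.IsBigO.trans_isLittleO (g := fun x => (x - s) ^ 2) ?_ ?_
  · refine Asymptotics.IsBigO.of_bound 1 (Filter.Eventually.of_forall fun x => ?_)
    rw [one_mul, Real.norm_of_nonneg (sq_nonneg _), Real.norm_eq_abs, abs_le, smul_eq_mul]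
    rcases le_total s 0 with hs | hs <;> rcases le_total x 0 with hx | hx <;>
      simp only [max_eq_left, max_eq_right, hs, hx] <;> constructor <;> nlinarith
  · refine Asymptotics.isLittleO_iff.2 fun ε hε => ?_
    filter_upwards [Metric.ball_mem_nhds s hε] with x hx
    rw [Metric.mem_ball, Real.dist_eq] at hx
    rw [Real.norm_eq_abs, Real.norm_eq_abs, abs_pow, sq]
    exact mul_le_mul_of_nonneg_right hx.le (abs_nonneg _)

theorem max_zero_sq_convex (s t : ℝ) : max s 0 ^ 2 + 2 * max s 0 * (t - s) ≤ max t 0 ^ 2 := by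
  rcases le_total s 0 with hs | hs <;> rcases le_total t 0 with ht | ht <;>
      simp only [max_eq_left, max_eq_right, hs, ht] <;> nlinarith [sq_nonneg (s - t)]

variable {n l m : ℕ}

theorem pos_apply (a : Vec m) (i : Fin m) : pos a i = max (a i) 0 := rfl

theorem norm_pos_sq (a : Vec m) : ‖pos a‖ ^ 2 = ∑ i, max (a i) 0 ^ 2 := by
  rw [EuclideanSpace.norm_sq_eq]
  exact Finset.sum_congr rfl fun i _ => by rw [pos_apply, Real.norm_eq_abs, sq_abs]

theorem norm_le_sum_abs (a : Vec m) : ‖a‖ ≤ ∑ i, |a i| := by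
  refine le_of_sq_le_sq ?_ (Finset.sum_nonneg fun i _ => abs_nonneg _)
  rw [EuclideanSpace.norm_sq_eq]
  exact Finset.sum_sq_le_sq_sum_of_nonneg fun i _ => abs_nonneg _

theorem abs_apply_le_norm (a : Vec m) (i : Fin m) : |a i| ≤ ‖a‖ := by
  simpa using PiLp.norm_apply_le a i

theorem WeaklyConvex.gradient_le {φ : Vec n → ℝ} {ρ : ℝ} (hc : WeaklyConvex φ ρ)
    (hφ : Differentiable ℝ φ) (x u : Vec n) :
    φ x + ⟪gradient φ x, u - x⟫ - ρ / 2 * ‖u - x‖ ^ 2 ≤ φ u := by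
  have hgrad : HasGradientAt (fun x => φ x + ρ / 2 * ‖x‖ ^ 2) (gradient φ x + ρ • x) x := by
    rw [hasGradientAt_iff_hasFDerivAt]
    refine ((hφ x).hasGradientAt.hasFDerivAt.add
      (((hasStrictFDerivAt_norm_sq x).hasFDerivAt).const_mul (ρ / 2))).congr_fderiv ?_
    ext v
    simp
    ring
  have h := ConvexOn.gradient_le hc (fun x => ((hφ x).add
    (((hasStrictFDerivAt_norm_sq x).hasFDerivAt).const_mul (ρ / 2)).differentiableAt)) x u
  rw [hgrad.gradient, inner_add_left, inner_smul_left] at h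
  have e := norm_sub_sq_real u x
  have e2 : ⟪x, u - x⟫ = ⟪u, x⟫ - ‖x‖ ^ 2 := by
    rw [inner_sub_right, real_inner_self_eq_norm_sq, real_inner_comm]
  simp only [conj_trivial, e2] at h
  rw [e]
  linarith

end Gradients

namespace Problem

variable {n l m : ℕ} (P : Problem n l m)

/-- The gradient of the smooth part of the augmented Lagrangian function. -/
noncomputable def alGrad (β : ℝ) (y : Vec l) (z : Vec m) (x : Vec n) : Vec n :=
  gradient P.g x + P.A.adjoint (y + β • (P.A x - P.b)) + P.jacT x (pos (z + β • P.fvec x))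

theorem inner_jacT (x : Vec n) (z : Vec m) (d : Vec n) :
    ⟪P.jacT x z, d⟫ = ∑ i, z i * ⟪gradient (P.f i) x, d⟫ := by
  simp [jacT, sum_inner, inner_smul_left]

theorem alSmooth_eq (β : ℝ) (y : Vec l) (z : Vec m) (x : Vec n) :
    P.alSmooth β y z x = P.g x + ⟪y, P.A x - P.b⟫ + β / 2 * ‖P.A x - P.b‖ ^ 2
      + 1 / (2 * β) * (∑ i, max (z i + β * P.f i x) 0 ^ 2 - ‖z‖ ^ 2) := by
  rw [alSmooth, norm_pos_sq]
  rfl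

variable {P} {c : Params m}

theorem hasGradientAt_alSmooth (hP : P.Assumptions c) {β : ℝ} (hβ : 0 < β) (y : Vec l) (z : Vec m)
    (x : Vec n) : HasGradientAt (P.alSmooth β y z) (P.alGrad β y z x) x := by
  have hfun : P.alSmooth β y z = fun x => P.g x + ⟪y, P.A x - P.b⟫ + β / 2 * ‖P.A x - P.b‖ ^ 2
      + 1 / (2 * β) * (∑ i, max (z i + β * P.f i x) 0 ^ 2 - ‖z‖ ^ 2) :=
    funext fun x => P.alSmooth_eq β y z x
  rw [hfun, hasGradientAt_iff_hasFDerivAt]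
  have hA : HasFDerivAt (fun x => P.A x - P.b) P.A x := P.A.hasFDerivAt.sub_const _
  have h1 := (hP.g_smooth.1 x).hasGradientAt.hasFDerivAt
  have h2 : HasFDerivAt (fun x => ⟪y, P.A x - P.b⟫) ((innerSL ℝ y).comp P.A) x :=
    (innerSL ℝ y).hasFDerivAt.comp x hA
  have h3 := (hA.norm_sq).const_mul (β / 2)
  have h4 : ∀ i ∈ Finset.univ, HasFDerivAt (fun x => max (z i + β * P.f i x) 0 ^ 2) _ x :=
    fun i _ => (hasDerivAt_max_zero_sq _).comp_hasFDerivAt x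
      ((((hP.f_smooth i).1 x).hasGradientAt.hasFDerivAt.const_mul β).const_add (z i))
  have h5 := ((HasFDerivAt.fun_sum h4).sub_const (‖z‖ ^ 2)).const_mul (1 / (2 * β))
  refine (((h1.add h2).add h3).add h5).congr_fderiv ?_
  ext d
  rw [InnerProductSpace.toDual_apply_apply, alGrad, inner_add_left, inner_add_left,
    ContinuousLinearMap.adjoint_inner_left, inner_add_left, inner_smul_left, inner_jacT]
  simp [Finset.mul_sum, pos_apply, fvec]
  have h6 : ∀ i, β⁻¹ * 2⁻¹ * (2 * max (z i + β * P.f i x) 0 * (β * (fderiv ℝ (P.f i) x) d))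
      = max (z i + β * P.f i x) 0 * (fderiv ℝ (P.f i) x) d := fun i => by
    field_simp
  simp only [h6, inner_sub_left]
  ring

/-- Only `g` contributes nonconvexity: the linear and quadratic terms in Ax - b are convex, and the
squared positive part is convex and nondecreasing, so its composition with the convex f_i is convex.
The modulus is therefore independent of β. -/
theorem alSmooth_first_order (hP : P.Assumptions c) {β : ℝ} (hβ : 0 < β) (y : Vec l) (z : Vec m)
    (x u : Vec n) :
    P.alSmooth β y z x + ⟪P.alGrad β y z x, u - x⟫ - c.ρ₀ / 2 * ‖u - x‖ ^ 2
      ≤ P.alSmooth β y z u := by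
  have h1 := hP.g_weak.gradient_le hP.g_smooth.1 x u
  have hAu : P.A u - P.b = (P.A x - P.b) + P.A (u - x) := by rw [map_sub]; abel
  have h2 : ∑ i, max (z i + β * P.f i x) 0 ^ 2
      + 2 * β * ∑ i, max (z i + β * P.f i x) 0 * ⟪gradient (P.f i) x, u - x⟫
      ≤ ∑ i, max (z i + β * P.f i u) 0 ^ 2 := by
    rw [Finset.mul_sum, ← Finset.sum_add_distrib]
    refine Finset.sum_le_sum fun i _ => ?_
    refine le_trans ?_ (max_zero_sq_convex (z i + β * P.f i x) (z i + β * P.f i u))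
    have h3 := ConvexOn.gradient_le (hP.f_convex i) (hP.f_smooth i).1 x u
    have h4 : 0 ≤ β * max (z i + β * P.f i x) 0 := mul_nonneg hβ.le (le_max_right _ _)
    nlinarith [mul_le_mul_of_nonneg_left h3 h4]
  have h3 : (1 / (2 * β)) * ∑ i, max (z i + β * P.f i x) 0 ^ 2
      + ∑ i, max (z i + β * P.f i x) 0 * ⟪gradient (P.f i) x, u - x⟫
      ≤ (1 / (2 * β)) * ∑ i, max (z i + β * P.f i u) 0 ^ 2 := by
    refine le_trans (le_of_eq ?_)
      (mul_le_mul_of_nonneg_left h2 (by positivity : 0 ≤ 1 / (2 * β)))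
    field_simp
  rw [alSmooth_eq, alSmooth_eq, hAu, inner_add_right, norm_add_sq_real, alGrad, inner_add_left,
    inner_add_left, ContinuousLinearMap.adjoint_inner_left, inner_add_left, inner_smul_left,
    inner_jacT]
  simp only [conj_trivial]
  have h4 : ∀ i, pos (z + β • P.fvec x) i = max (z i + β * P.f i x) 0 := fun i => rfl
  simp only [h4]
  have h5 := mul_nonneg (half_pos hβ).le (sq_nonneg ‖P.A (u - x)‖)
  linarith

theorem dom_convex (hP : P.Assumptions c) : Convex ℝ P.dom := hP.h_convex.1

theorem extDom_convex (hP : P.Assumptions c) : Convex ℝ P.extDom :=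
  Convex.extrapolationSet (dom_convex hP)

theorem dom_subset_extDom (P : Problem n l m) : P.dom ⊆ P.extDom := subset_extrapolationSet _

theorem abs_f_le (hP : P.Assumptions c) (i : Fin m) {x : Vec n} (hx : x ∈ P.extDom) :
    |P.f i x| ≤ c.Bf i := (le_max_left _ _).trans (hP.f_bound i x hx)

theorem norm_gradient_f_le (hP : P.Assumptions c) (i : Fin m) {x : Vec n} (hx : x ∈ P.extDom) :
    ‖gradient (P.f i) x‖ ≤ c.Bf i := (le_max_right _ _).trans (hP.f_bound i x hx)

theorem abs_f_sub_le (hP : P.Assumptions c) (i : Fin m) {x y : Vec n} (hx : x ∈ P.extDom)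
    (hy : y ∈ P.extDom) : |P.f i x - P.f i y| ≤ c.Bf i * ‖x - y‖ := by
  refine (extDom_convex hP).norm_image_sub_le_of_norm_fderiv_le
    (fun w _ => (hP.f_smooth i).1 w) (fun w hw => ?_) hy hx
  rw [← toDual_gradient, LinearIsometryEquiv.norm_map]
  exact norm_gradient_f_le hP i hw

theorem norm_alGrad_sub_le (hP : P.Assumptions c) {β : ℝ} (hβ : 0 < β)
    (y : Vec l) (z : Vec m) {u w : Vec n} (hu : u ∈ P.extDom) (hw : w ∈ P.extDom) :
    ‖P.alGrad β y z u - P.alGrad β y z w‖ ≤ (c.L₀ + β * ‖P.A.adjoint ∘L P.A‖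
      + ∑ i, (β * c.Bf i * (c.Bf i + c.Lf i) + c.Lf i * |z i|)) * ‖u - w‖ := by
  have hdecomp : P.alGrad β y z u - P.alGrad β y z w = (gradient P.g u - gradient P.g w)
      + β • (P.A.adjoint ∘L P.A) (u - w)
      + ∑ i, (max (z i + β * P.f i u) 0 • gradient (P.f i) u
        - max (z i + β * P.f i w) 0 • gradient (P.f i) w) := by
    rw [Finset.sum_sub_distrib]
    simp only [alGrad, map_add, map_smul, map_sub, ContinuousLinearMap.comp_apply]
    change _ + ∑ i, max (z i + β * P.f i u) 0 • gradient (P.f i) u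
      - (_ + ∑ i, max (z i + β * P.f i w) 0 • gradient (P.f i) w) = _
    module
  rw [hdecomp, add_mul, add_mul, Finset.sum_mul]
  refine (norm_add_le _ _).trans (add_le_add ((norm_add_le _ _).trans (add_le_add ?_ ?_)) ?_)
  · exact hP.g_smooth.2 u w
  · rw [norm_smul, Real.norm_of_nonneg hβ.le, mul_assoc]
    exact mul_le_mul_of_nonneg_left (ContinuousLinearMap.le_opNorm _ _) hβ.le
  · refine (norm_sum_le _ _).trans (Finset.sum_le_sum fun i _ => ?_)
    set p := max (z i + β * P.f i u) 0
    set q := max (z i + β * P.f i w) 0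
    -- Product rule for differences: the first term uses the Lipschitz bound of f_i on the convex
    -- set `extDom`, the second the smoothness of f_i and the size of the multiplier.
    have e : p • gradient (P.f i) u - q • gradient (P.f i) w
        = (p - q) • gradient (P.f i) u + q • (gradient (P.f i) u - gradient (P.f i) w) := by
      module
    have hB : 0 ≤ c.Bf i := (norm_nonneg _).trans (norm_gradient_f_le hP i hu)
    have h1 : |p - q| ≤ β * (c.Bf i * ‖u - w‖) := by
      refine (abs_max_sub_max_le_abs _ _ _).trans ?_
      rw [add_sub_add_left_eq_sub, ← mul_sub, abs_mul, abs_of_pos hβ]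
      exact mul_le_mul_of_nonneg_left (abs_f_sub_le hP i hu hw) hβ.le
    have h2 : |q| ≤ |z i| + β * c.Bf i := by
      rw [abs_of_nonneg (le_max_right _ _)]
      have h3 := mul_le_mul_of_nonneg_left (abs_f_le hP i hw) hβ.le
      refine max_le (add_le_add (le_abs_self _) (le_trans ?_ h3)) (by positivity)
      exact mul_le_mul_of_nonneg_left (le_abs_self _) hβ.le
    rw [e]
    refine (norm_add_le _ _).trans ?_
    rw [norm_smul, norm_smul, Real.norm_eq_abs, Real.norm_eq_abs]
    have h3 := mul_le_mul h1 (norm_gradient_f_le hP i hu) (norm_nonneg _) (by positivity)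
    have h4 := mul_le_mul h2 ((hP.f_smooth i).2 u w) (norm_nonneg _) (by positivity)
    linarith

theorem beta_pos (hP : P.Assumptions c) (k : ℕ) : 0 < beta c k :=
  mul_pos hP.beta_pos (pow_pos (zero_lt_one.trans hP.sigma_gt) k)

theorem hasGradientAt_subG (hP : P.Assumptions c) (k : ℕ) (y : Vec l) (z : Vec m)
    (center x : Vec n) : HasGradientAt (P.subG c k y z center)
      (P.alGrad (beta c k) y z x + (2 * c.ρ₀) • (x - center)) x := by
  rw [hasGradientAt_iff_hasFDerivAt]
  refine (((hasGradientAt_alSmooth hP (beta_pos hP k) y z x).hasFDerivAt).add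
    ((((hasFDerivAt_id x).sub_const center).norm_sq).const_mul c.ρ₀)).congr_fderiv ?_
  ext d
  simp
  ring

/-- In dimension zero the Lipschitz condition is vacuous and allows a negative constant, hence the
nontriviality assumption and the separate zero-dimensional case in `exists_apgTest_subG`. -/
theorem lsmooth_nonneg [Nontrivial (Vec n)] {φ : Vec n → ℝ} {L : ℝ} (h : LSmooth φ L) :
    0 ≤ L := by
  obtain ⟨x, y, hxy⟩ := exists_pair_ne (Vec n)
  exact nonneg_of_mul_nonneg_left ((norm_nonneg _).trans (h.2 x y))
    (norm_pos_iff.2 (sub_ne_zero.2 hxy))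

theorem Lhat_nonneg [Nontrivial (Vec n)] (hP : P.Assumptions c) (hne : P.dom.Nonempty) (k : ℕ)
    (z : Vec m) : 0 ≤ P.Lhat c k z := by
  obtain ⟨x, hx⟩ := hne
  have h0 := lsmooth_nonneg hP.g_smooth
  have h1 := fun i => lsmooth_nonneg (hP.f_smooth i)
  have h2 := fun i => (abs_nonneg _).trans (abs_f_le hP i (dom_subset_extDom P hx))
  have h3 := (beta_pos hP k).le
  refine add_nonneg (add_nonneg h0 (mul_nonneg h3 (norm_nonneg _)))
    (Finset.sum_nonneg fun i _ => add_nonneg ?_ (mul_nonneg (h1 i) (abs_nonneg _)))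
  exact mul_nonneg (mul_nonneg h3 (h2 i)) (add_nonneg (h2 i) (h1 i))

/-- The subproblems of the proximal point method are strongly convex composite models. -/
theorem compositeModel_subG [Nontrivial (Vec n)] (hP : P.Assumptions c) (hne : P.dom.Nonempty)
    (k : ℕ) (y : Vec l) (z : Vec m) (center : Vec n) :
    CompositeModel P.dom P.h (P.subG c k y z center) c.ρ₀ (P.Lhat c k z + 2 * c.ρ₀) where
  compact := hP.dom_compact
  convex := hP.h_convex
  closed := hP.h_closed
  diff x := (hasGradientAt_subG hP k y z center x).differentiableAt
  strong x u := by
    rw [(hasGradientAt_subG hP k y z center x).gradient]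
    have h := alSmooth_first_order hP (beta_pos hP k) y z x u
    have e : u - center = (x - center) + (u - x) := by abel
    simp only [subG]
    rw [e, norm_add_sq_real, inner_add_left, inner_smul_left]
    simp only [conj_trivial]
    linarith
  lip x hx w hw := by
    rw [(hasGradientAt_subG hP k y z center x).gradient,
      (hasGradientAt_subG hP k y z center w).gradient]
    have h := norm_alGrad_sub_le hP (beta_pos hP k) y z hx hw
    have e : P.alGrad (beta c k) y z x + (2 * c.ρ₀) • (x - center)
        - (P.alGrad (beta c k) y z w + (2 * c.ρ₀) • (w - center))
        = (P.alGrad (beta c k) y z x - P.alGrad (beta c k) y z w) + (2 * c.ρ₀) • (x - w) := by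
      module
    rw [e, add_mul]
    refine (norm_add_le _ _).trans (add_le_add h ?_)
    rw [norm_smul, Real.norm_of_nonneg (mul_pos two_pos hP.rho_pos).le]
  mu_pos := hP.rho_pos
  mu_le := by
    have := Lhat_nonneg hP hne k z
    have := hP.rho_pos
    linarith

end Problem
end IALM

/-! ### APG calls and proximal point calls inside the run. -/

namespace IALM
namespace Problem

variable {n l m : ℕ} {P : Problem n l m} {c : Params m}

/-- An APG call of the method reaches its stopping test within the number of iterations given by
any upper bound `Lb` of the smoothness constant. -/
theorem exists_apgTest_subG (hP : P.Assumptions c) {κ : ℝ}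
    (hκ : ∀ x ∈ P.dom, ∀ y ∈ P.dom, ‖x - y‖ ≤ κ) {ε : ℝ} (hε : 0 < ε) (k : ℕ) (y : Vec l)
    (z : Vec m) {Lb : ℝ} (hLb0 : 0 < Lb) (hLb : P.Lhat c k z + 2 * c.ρ₀ ≤ Lb) (center : Vec n)
    {xm : Vec n} (hxm : xm ∈ P.dom) :
    (∀ t, (apgIter P.dom P.h (P.subG c k y z center) c.ρ₀ (P.Lhat c k z + 2 * c.ρ₀) xm t).x
      ∈ P.dom) ∧
    ∃ t : ℕ, (t : ℝ) ≤ √(Lb / c.ρ₀) * Real.log (1 + 256 * Lb ^ 3 * κ ^ 2 / (c.ρ₀ * ε ^ 2)) + 1 ∧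
      apgTest P.dom P.h (P.subG c k y z center) (ε / 4)
        (apgIter P.dom P.h (P.subG c k y z center) c.ρ₀ (P.Lhat c k z + 2 * c.ρ₀) xm (t + 1)).x := by
  have hρ := hP.rho_pos
  have hfrac : 0 ≤ 256 * Lb ^ 3 * κ ^ 2 / (c.ρ₀ * ε ^ 2) := by positivity
  have hlog := Real.log_nonneg (le_add_of_nonneg_right hfrac)
  rcases subsingleton_or_nontrivial (Vec n) with hsub | hnt
  · have hmem : ∀ x : Vec n, x ∈ P.dom := fun x => Subsingleton.elim xm x ▸ hxm
    refine ⟨fun t => hmem _, 0, by push_cast; positivity, ?_⟩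
    have hmin : ∀ s x : Vec n, s ∈ subdiff P.dom P.h x := fun s x => by
      refine ⟨hmem _, fun u _ => ?_⟩
      rw [Subsingleton.elim (u - x) 0, inner_zero_right, add_zero, Subsingleton.elim u x]
    exact (Metric.infEDist_zero_of_mem (hmin _ _)).trans_le zero_le
  · have M := compositeModel_subG hP ⟨xm, hxm⟩ k y z center
    refine ⟨fun t => (M.apgIter_invariant hκ hxm hxm t).1, ?_⟩
    obtain ⟨t, ht, htest⟩ := M.exists_apgTest (δ := ε / 4) hκ hxm (by positivity)
      (le_add_of_nonneg_right hfrac) (by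
        have h1 := pow_le_pow_left₀ M.L_pos.le hLb 3
        have h2 : 16 * (P.Lhat c k z + 2 * c.ρ₀) ^ 3 * κ ^ 2 ≤ 16 * Lb ^ 3 * κ ^ 2 := by
          gcongr
        refine h2.trans ?_
        have h3 : c.ρ₀ * (ε / 4) ^ 2 * (1 + 256 * Lb ^ 3 * κ ^ 2 / (c.ρ₀ * ε ^ 2))
            = c.ρ₀ * (ε / 4) ^ 2 + 16 * Lb ^ 3 * κ ^ 2 := by
          field_simp
          ring
        rw [h3]
        exact le_add_of_nonneg_left (by positivity))
    refine ⟨t, ht.trans ?_, htest⟩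
    gcongr

/-- The equality multiplier at the end of an outer iteration. -/
noncomputable def newY (P : Problem n l m) (c : Params m) (x0 : Vec n) (k : ℕ) (y : Vec l)
    (x : Vec n) : Vec l := y + P.wstep c x0 k x • (P.A x - P.b)

/-- The inequality multiplier at the end of an outer iteration. -/
noncomputable def newZ (P : Problem n l m) (c : Params m) (x0 : Vec n) (k : ℕ) (z : Vec m)
    (x : Vec n) : Vec m :=
  WithLp.toLp 2 fun i => z i + P.wstep c x0 k x * max (-(z i / beta c k)) (P.f i x)

section Run

variable {ε : ℝ} {x0 : Vec n} {xm : ℕ → Vec n}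

theorem step_eq_next_apg (s : State n l m) (xm' : Vec n)
    (h : ¬ apgTest P.dom P.h (P.subG c s.k s.y s.z s.center) (ε / 4)
      (apgStep P.dom P.h (P.subG c s.k s.y s.z s.center) c.ρ₀ (P.Lhat c s.k s.z + 2 * c.ρ₀)
        s.apg).x) :
    P.step c ε x0 xm' s = { s with apg := (apgStep P.dom P.h (P.subG c s.k s.y s.z s.center) c.ρ₀
      (P.Lhat c s.k s.z + 2 * c.ρ₀) s.apg) } := if_neg h

theorem step_eq_outer (s : State n l m) (xm' : Vec n) {x : Vec n}
    (hx : (apgStep P.dom P.h (P.subG c s.k s.y s.z s.center) c.ρ₀ (P.Lhat c s.k s.z + 2 * c.ρ₀)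
        s.apg).x = x)
    (h : apgTest P.dom P.h (P.subG c s.k s.y s.z s.center) (ε / 4) x)
    (h' : 2 * c.ρ₀ * ‖x - s.center‖ ≤ ε / 2) :
    P.step c ε x0 xm' s
      = P.startCall c (s.k + 1) (P.newY c x0 s.k s.y x) (P.newZ c x0 s.k s.z x) x xm' := by
  subst hx
  exact (if_pos h).trans (if_pos h')

theorem step_eq_prox (s : State n l m) (xm' : Vec n) {x : Vec n}
    (hx : (apgStep P.dom P.h (P.subG c s.k s.y s.z s.center) c.ρ₀ (P.Lhat c s.k s.z + 2 * c.ρ₀)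
        s.apg).x = x)
    (h : apgTest P.dom P.h (P.subG c s.k s.y s.z s.center) (ε / 4) x)
    (h' : ¬ 2 * c.ρ₀ * ‖x - s.center‖ ≤ ε / 2) :
    P.step c ε x0 xm' s = P.startCall c s.k s.y s.z x xm' := by
  subst hx
  exact (if_pos h).trans (if_neg h')

/-- The course of one APG call within the run of the method. -/
theorem run_call {N₀ k : ℕ} {y : Vec l} {z : Vec m} {center xm' : Vec n}
    (h0 : P.run c ε x0 xm N₀ = P.startCall c k y z center xm')
    (hdom : ∀ t, (apgIter P.dom P.h (P.subG c k y z center) c.ρ₀ (P.Lhat c k z + 2 * c.ρ₀) xm' t).x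
      ∈ P.dom) {W : ℝ}
    (hW : ∃ t : ℕ, (t : ℝ) ≤ W ∧ apgTest P.dom P.h (P.subG c k y z center) (ε / 4)
      (apgIter P.dom P.h (P.subG c k y z center) c.ρ₀ (P.Lhat c k z + 2 * c.ρ₀) xm' (t + 1)).x) :
    ∃ N : ℕ, (N : ℝ) ≤ N₀ + W ∧ ∃ x ∈ P.dom,
      apgTest P.dom P.h (P.subG c k y z center) (ε / 4) x ∧ (P.run c ε x0 xm N).k = k ∧
      (2 * c.ρ₀ * ‖x - center‖ ≤ ε / 2 → P.run c ε x0 xm (N + 1)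
        = P.startCall c (k + 1) (P.newY c x0 k y x) (P.newZ c x0 k z x) x (xm (N + 1))) ∧
      (¬ 2 * c.ρ₀ * ‖x - center‖ ≤ ε / 2 →
        P.run c ε x0 xm (N + 1) = P.startCall c k y z x (xm (N + 1))) := by
  classical
  set it := apgIter P.dom P.h (P.subG c k y z center) c.ρ₀ (P.Lhat c k z + 2 * c.ρ₀) xm' with hit
  have hex : ∃ t : ℕ, apgTest P.dom P.h (P.subG c k y z center) (ε / 4) (it (t + 1)).x :=
    hW.imp fun _ h => h.2
  -- Up to the first passed test the run merely copies the APG iteration; the test at index j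
  -- concerns the iterate j + 1, so the call consumes one iteration more than `Nat.find hex`.
  have hrun : ∀ j ≤ Nat.find hex, P.run c ε x0 xm (N₀ + j) = ⟨k, y, z, center, it j⟩ := by
    intro j
    induction j with
    | zero =>
      intro _
      rw [add_zero, h0]
      rfl
    | succ j ih =>
      intro hj
      have h1 := ih (Nat.le_of_succ_le hj)
      have h2 := Nat.find_min hex (Nat.lt_of_succ_le hj)
      rw [← add_assoc, run, h1]
      exact step_eq_next_apg ⟨k, y, z, center, it j⟩ _ h2
  have hlast := hrun _ le_rfl
  obtain ⟨t, htW, ht⟩ := hW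
  have hle : (Nat.find hex : ℝ) ≤ W := (Nat.cast_le.2 (Nat.find_min' hex ht)).trans htW
  have htest := Nat.find_spec hex
  refine ⟨N₀ + Nat.find hex, by push_cast; linarith, _, hdom (Nat.find hex + 1), htest,
    by rw [hlast], fun h => ?_, fun h => ?_⟩
  · rw [run, hlast]
    exact step_eq_outer ⟨k, y, z, center, it (Nat.find hex)⟩ _ rfl htest h
  · rw [run, hlast]
    exact step_eq_prox ⟨k, y, z, center, it (Nat.find hex)⟩ _ rfl htest h

end Run

/-- The slack between `δ` and `δ'` makes it unnecessary that the distance be attained. -/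
theorem exists_subgradient_of_apgTest {D : Set (Vec n)} {H G : Vec n → ℝ} {δ δ' : ℝ} {x : Vec n}
    (h : apgTest D H G δ x) (h0 : 0 < δ') (hδ : δ < δ') :
    ∃ s ∈ subdiff D H x, ‖gradient G x + s‖ ≤ δ' := by
  have h1 : Metric.infEDist (-gradient G x) (subdiff D H x) < ENNReal.ofReal δ' :=
    lt_of_le_of_lt h ((ENNReal.ofReal_lt_ofReal_iff h0).2 hδ)
  obtain ⟨s, hs, h2⟩ := Metric.infEDist_lt_iff.1 h1
  rw [edist_dist, ENNReal.ofReal_lt_ofReal_iff h0, dist_eq_norm] at h2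
  refine ⟨s, hs, ?_⟩
  rw [← norm_neg, neg_add]
  exact h2.le

/-- Inexact proximal point steps decrease the objective, up to the subproblem tolerance. -/
theorem prox_descent (hP : P.Assumptions c) {k : ℕ} {y : Vec l} {z : Vec m} {center x s : Vec n}
    (hc : center ∈ P.dom) {δ : ℝ} (hs : s ∈ subdiff P.dom P.h x)
    (hδ : ‖gradient (P.subG c k y z center) x + s‖ ≤ δ) :
    P.alSmooth (beta c k) y z x + P.h x + 3 / 2 * c.ρ₀ * ‖x - center‖ ^ 2 - δ * ‖x - center‖
      ≤ P.alSmooth (beta c k) y z center + P.h center := by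
  rw [(hasGradientAt_subG hP k y z center x).gradient] at hδ
  have h1 := alSmooth_first_order hP (beta_pos hP k) y z x center
  have h2 := hs.2 center hc
  set g := P.alGrad (beta c k) y z x
  have e : ⟪g, center - x⟫ + ⟪s, center - x⟫
      = 2 * c.ρ₀ * ‖x - center‖ ^ 2 - ⟪g + (2 * c.ρ₀) • (x - center) + s, x - center⟫ := by
    have e1 : center - x = -(x - center) := by abel
    rw [e1, inner_neg_right, inner_neg_right, inner_add_left, inner_add_left, inner_smul_left,
      real_inner_self_eq_norm_sq]
    simp only [conj_trivial]
    ring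
  have h3 : ⟪g + (2 * c.ρ₀) • (x - center) + s, x - center⟫ ≤ δ * ‖x - center‖ :=
    (real_inner_le_norm _ _).trans (mul_le_mul_of_nonneg_right hδ (norm_nonneg _))
  rw [norm_sub_rev center x] at h1
  linarith

/-- The course of one call of the inexact proximal point method within the run of the method. -/
theorem run_prox (hP : P.Assumptions c) {ε : ℝ} (hε : 0 < ε) {x0 : Vec n} {xm : ℕ → Vec n}
    (hxm : ∀ N, xm N ∈ P.dom) {k : ℕ} {y : Vec l} {z : Vec m} {W μ₀ : ℝ}
    (hdom : ∀ center xm', xm' ∈ P.dom → ∀ t, (apgIter P.dom P.h (P.subG c k y z center) c.ρ₀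
      (P.Lhat c k z + 2 * c.ρ₀) xm' t).x ∈ P.dom)
    (hW : ∀ center xm', xm' ∈ P.dom → ∃ t : ℕ, (t : ℝ) ≤ W ∧
      apgTest P.dom P.h (P.subG c k y z center) (ε / 4)
      (apgIter P.dom P.h (P.subG c k y z center) c.ρ₀ (P.Lhat c k z + 2 * c.ρ₀) xm' (t + 1)).x)
    (hμ : ∀ x ∈ P.dom, μ₀ ≤ P.alSmooth (beta c k) y z x + P.h x) (J : ℕ) :
    ∀ (N₀ : ℕ) (center xm' : Vec n), center ∈ P.dom → xm' ∈ P.dom →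
      P.run c ε x0 xm N₀ = P.startCall c k y z center xm' →
      P.alSmooth (beta c k) y z center + P.h center - μ₀ < (J + 1) * (ε ^ 2 / (96 * c.ρ₀)) →
      ∃ N : ℕ, ((N + 1 : ℕ) : ℝ) ≤ N₀ + (J + 1) * (W + 1) ∧ ∃ x ∈ P.dom,
        (∃ s ∈ subdiff P.dom P.h x, ‖P.alGrad (beta c k) y z x + s‖ ≤ ε) ∧
        P.alSmooth (beta c k) y z x + P.h x
          ≤ P.alSmooth (beta c k) y z center + P.h center + ε ^ 2 / c.ρ₀ ∧
        (P.run c ε x0 xm N).k = k ∧ P.run c ε x0 xm (N + 1)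
          = P.startCall c (k + 1) (P.newY c x0 k y x) (P.newZ c x0 k z x) x (xm (N + 1)) := by
  have hρ := hP.rho_pos
  have hW0 : 0 ≤ W := by
    obtain ⟨t, ht, -⟩ := hW (xm 0) (xm 0) (hxm 0)
    exact (Nat.cast_nonneg t).trans ht
  have hstep : ∀ (N₀ : ℕ) (center xm' : Vec n), center ∈ P.dom → xm' ∈ P.dom →
      P.run c ε x0 xm N₀ = P.startCall c k y z center xm' →
      ∃ N : ℕ, (N : ℝ) ≤ N₀ + W ∧ ∃ x ∈ P.dom,
        ((∃ s ∈ subdiff P.dom P.h x, ‖P.alGrad (beta c k) y z x + s‖ ≤ ε) ∧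
          P.alSmooth (beta c k) y z x + P.h x
            ≤ P.alSmooth (beta c k) y z center + P.h center + ε ^ 2 / c.ρ₀ ∧
          (P.run c ε x0 xm N).k = k ∧ P.run c ε x0 xm (N + 1)
            = P.startCall c (k + 1) (P.newY c x0 k y x) (P.newZ c x0 k z x) x (xm (N + 1))) ∨
        (P.alSmooth (beta c k) y z x + P.h x + ε ^ 2 / (96 * c.ρ₀)
            ≤ P.alSmooth (beta c k) y z center + P.h center ∧
          P.run c ε x0 xm (N + 1) = P.startCall c k y z x (xm (N + 1))) := by
    intro N₀ center xm' hc hxm' h0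
    obtain ⟨N, hN, x, hx, htest, hk, h_outer, hcont⟩ := run_call h0 (hdom center xm' hxm')
      (hW center xm' hxm')
    -- The tolerance ε/4 is relaxed to ε/3, which still leaves room: ε/3 + ε/2 ≤ ε when the proximal
    -- term is removed.
    obtain ⟨s, hs, hsn⟩ := exists_subgradient_of_apgTest htest (δ' := ε / 3) (by positivity)
      (by linarith)
    have hdesc := prox_descent hP hc hs hsn
    refine ⟨N, hN, x, hx, ?_⟩
    have hd := norm_nonneg (x - center)
    by_cases h : 2 * c.ρ₀ * ‖x - center‖ ≤ ε / 2
    · refine Or.inl ⟨⟨s, hs, ?_⟩, ?_, hk, h_outer h⟩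
      · rw [(hasGradientAt_subG hP k y z center x).gradient] at hsn
        have e : P.alGrad (beta c k) y z x + s = (P.alGrad (beta c k) y z x
            + (2 * c.ρ₀) • (x - center) + s) - (2 * c.ρ₀) • (x - center) := by abel
        rw [e]
        refine (norm_sub_le _ _).trans ?_
        rw [norm_smul, Real.norm_of_nonneg (by positivity)]
        linarith
      · have h2 : ε / 3 * ‖x - center‖ ≤ ε ^ 2 / c.ρ₀ := by
          rw [le_div_iff₀ hρ]
          nlinarith
        have h3 : 0 ≤ 3 / 2 * c.ρ₀ * ‖x - center‖ ^ 2 := by positivity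
        linarith
    · refine Or.inr ⟨?_, hcont h⟩
      rw [not_le] at h
      -- With q = ρ₀d > ε/4, one has 3q²/2 - εq/3 ≥ 3q²/2 - 4q²/3 = q²/6 ≥ ε²/96.
      have h2 : ε ^ 2 / (96 * c.ρ₀)
          ≤ 3 / 2 * c.ρ₀ * ‖x - center‖ ^ 2 - ε / 3 * ‖x - center‖ := by
        rw [div_le_iff₀ (by positivity)]
        set d := ‖x - center‖
        have h3 : ε ^ 2 ≤ (4 * (c.ρ₀ * d)) ^ 2 :=
          pow_le_pow_left₀ hε.le (by linarith) 2
        have h4 : (c.ρ₀ * d) * ε ≤ (c.ρ₀ * d) * (4 * (c.ρ₀ * d)) :=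
          mul_le_mul_of_nonneg_left (by linarith) (by positivity)
        nlinarith
      linarith
  induction J with
  | zero =>
    intro N₀ center xm' hc hxm' h0 hgap
    obtain ⟨N, hN, x, hx, ⟨hs, hd, hk, hrun⟩ | ⟨hd, -⟩⟩ := hstep N₀ center xm' hc hxm' h0
    · exact ⟨N, by push_cast; linarith, x, hx, hs, hd, hk, hrun⟩
    -- A further decrease would push the objective below its lower bound, so this call must
    -- terminate.
    · have := hμ x hx
      simp only [Nat.cast_zero, zero_add, one_mul] at hgap
      linarith
  | succ J ih =>
    intro N₀ center xm' hc hxm' h0 hgap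
    push_cast at hgap ⊢
    obtain ⟨N, hN, x, hx, ⟨hs, hd, hk, hrun⟩ | ⟨hd, hrun⟩⟩ := hstep N₀ center xm' hc hxm' h0
    · refine ⟨N, ?_, x, hx, hs, hd, hk, hrun⟩
      have : 0 ≤ ((J : ℝ) + 1) * (W + 1) := by positivity
      linarith
    · have hε2 : 0 ≤ ε ^ 2 / (96 * c.ρ₀) := by positivity
      obtain ⟨N', hN', x', hx', hs', hd', hk', hrun'⟩ := ih (N + 1) x _ hx (hxm _) hrun
        (by linarith)
      push_cast at hN'
      exact ⟨N', by linarith, x', hx', hs', by linarith, hk', hrun'⟩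

end Problem
end IALM

/-! ### Uniform bounds, feasibility from regularity, and the KKT certificate. -/

namespace IALM

theorem norm_le_norm_of_abs_le {m : ℕ} {a b : Vec m} (h : ∀ i, |a i| ≤ |b i|) : ‖a‖ ≤ ‖b‖ := by
  refine le_of_sq_le_sq ?_ (norm_nonneg _)
  rw [EuclideanSpace.norm_sq_eq, EuclideanSpace.norm_sq_eq]
  exact Finset.sum_le_sum fun i _ => pow_le_pow_left₀ (norm_nonneg _) (h i) 2

theorem norm_pos_add_le {m : ℕ} (z a : Vec m) {β : ℝ} (hβ : 0 ≤ β) :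
    ‖pos (z + β • a)‖ ≤ ‖z‖ + β * ‖pos a‖ := by
  have h1 : ‖pos (z + β • a)‖ ≤ ‖pos z + β • pos a‖ := by
    refine norm_le_norm_of_abs_le fun i => ?_
    change |max (z i + β * a i) 0| ≤ |max (z i) 0 + β * max (a i) 0|
    have h2 : 0 ≤ β * max (a i) 0 := mul_nonneg hβ (le_max_right _ _)
    rw [abs_of_nonneg (le_max_right _ _),
      abs_of_nonneg (add_nonneg (le_max_right _ _) h2)]
    exact max_le (add_le_add (le_max_left _ _) (mul_le_mul_of_nonneg_left (le_max_left _ _) hβ))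
      (add_nonneg (le_max_right _ _) h2)
  refine h1.trans ((norm_add_le _ _).trans (add_le_add ?_ ?_))
  · refine norm_le_norm_of_abs_le fun i => ?_
    rw [pos_apply, abs_of_nonneg (le_max_right _ _)]
    exact max_le (le_abs_self _) (abs_nonneg _)
  · rw [norm_smul, Real.norm_of_nonneg hβ]

theorem norm_pos_sub_le {m : ℕ} (z a : Vec m) {β : ℝ} (hβ : 0 ≤ β) :
    ‖pos (z + β • a) - β • pos a‖ ≤ ‖z‖ := by
  refine norm_le_norm_of_abs_le fun i => ?_
  change |max (z i + β * a i) 0 - β * max (a i) 0| ≤ |z i|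
  rw [mul_max_of_nonneg _ _ hβ, mul_zero]
  refine (abs_max_sub_max_le_abs _ _ _).trans ?_
  rw [add_sub_cancel_right]

namespace Problem

variable {n l m : ℕ} {P : Problem n l m} {c : Params m}

/-- The total constraint violation. -/
noncomputable def residual (P : Problem n l m) (x : Vec n) : ℝ :=
  √(‖P.A x - P.b‖ ^ 2 + ‖pos (P.fvec x)‖ ^ 2)

theorem residual_nonneg (P : Problem n l m) (x : Vec n) : 0 ≤ P.residual x := Real.sqrt_nonneg _

theorem residual_sq (P : Problem n l m) (x : Vec n) :
    P.residual x ^ 2 = ‖P.A x - P.b‖ ^ 2 + ‖pos (P.fvec x)‖ ^ 2 :=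
  Real.sq_sqrt (by positivity)

theorem norm_eq_le_residual (P : Problem n l m) (x : Vec n) : ‖P.A x - P.b‖ ≤ P.residual x :=
  Real.le_sqrt_of_sq_le (le_add_of_nonneg_right (sq_nonneg _))

theorem norm_ineq_le_residual (P : Problem n l m) (x : Vec n) :
    ‖pos (P.fvec x)‖ ≤ P.residual x :=
  Real.le_sqrt_of_sq_le (le_add_of_nonneg_left (sq_nonneg _))

/-- A single constant that bounds all data of the problem over `dom h`. -/
structure UniformBound (P : Problem n l m) (c : Params m) (κ : ℝ) : Prop where
  one_le : 1 ≤ κ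
  eq_le : ∀ x ∈ P.dom, ‖P.A x - P.b‖ ≤ κ
  grad_le : ∀ x ∈ P.dom, ‖gradient P.g x‖ ≤ κ
  g_le : ∀ x ∈ P.dom, |P.g x| ≤ κ
  h_ge : ∀ x ∈ P.dom, -κ ≤ P.h x
  diam_le : ∀ x ∈ P.dom, ∀ y ∈ P.dom, ‖x - y‖ ≤ κ
  adj_le : ‖P.A.adjoint‖ ≤ κ
  sum_le : ∑ i, |c.Bf i| ≤ κ

theorem LSmooth.continuous_gradient {φ : Vec n → ℝ} {L : ℝ} (h : LSmooth φ L) :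
    Continuous (gradient φ) :=
  (LipschitzWith.of_dist_le' (K := L) fun x y => by
    rw [dist_eq_norm, dist_eq_norm]; exact h.2 x y).continuous

theorem exists_uniformBound (hP : P.Assumptions c) (hne : P.dom.Nonempty) :
    ∃ κ, P.UniformBound c κ := by
  have hK := hP.dom_compact
  obtain ⟨C1, h1⟩ := hK.exists_bound_of_continuousOn (f := fun x => P.A x - P.b)
    (Continuous.continuousOn (by fun_prop))
  obtain ⟨C2, h2⟩ := hK.exists_bound_of_continuousOn (f := gradient P.g)
    (LSmooth.continuous_gradient hP.g_smooth).continuousOn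
  obtain ⟨C3, h3⟩ := hK.exists_bound_of_continuousOn (f := P.g)
    hP.g_smooth.1.continuous.continuousOn
  -- Lower semicontinuity bounds `h` only from below; upper control of the objective comes later
  -- from descent.
  obtain ⟨p, -, h4⟩ := hP.h_closed.exists_isMinOn hne hK
  obtain ⟨C5, h5⟩ := hK.exists_bound_of_continuousOn (f := fun x => x) continuousOn_id
  have hs : 0 ≤ ∑ i, |c.Bf i| := Finset.sum_nonneg fun i _ => abs_nonneg _
  have a1 := abs_nonneg C1
  have a2 := abs_nonneg C2
  have a3 := abs_nonneg C3
  have a4 := abs_nonneg (P.h p)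
  have a5 := abs_nonneg C5
  have a6 := norm_nonneg P.A.adjoint
  have b1 := le_abs_self C1
  have b2 := le_abs_self C2
  have b3 := le_abs_self C3
  have b4 := neg_abs_le (P.h p)
  have b5 := le_abs_self C5
  refine ⟨1 + |C1| + |C2| + |C3| + |P.h p| + 2 * |C5| + ‖P.A.adjoint‖ + ∑ i, |c.Bf i|,
    by linarith, fun x hx => (h1 x hx).trans (by linarith),
    fun x hx => (h2 x hx).trans (by linarith), fun x hx => (h3 x hx).trans (by linarith),
    fun x hx => ?_, fun x hx y hy => ?_, by linarith, by linarith⟩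
  · have := isMinOn_iff.1 h4 x hx
    linarith
  · refine (norm_sub_le _ _).trans ?_
    have := h5 x hx
    have := h5 y hy
    linarith

theorem norm_jacT_le (hP : P.Assumptions c) {κ : ℝ} (hB : P.UniformBound c κ) {x : Vec n}
    (hx : x ∈ P.dom) (z : Vec m) : ‖P.jacT x z‖ ≤ κ * ‖z‖ := by
  refine (norm_sum_le _ _).trans ((?_ : _ ≤ ∑ i, |c.Bf i| * ‖z‖).trans ?_)
  · refine Finset.sum_le_sum fun i _ => ?_
    rw [norm_smul, mul_comm]
    exact mul_le_mul ((norm_gradient_f_le hP i (dom_subset_extDom P hx)).trans (le_abs_self _))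
      (abs_apply_le_norm z i) (norm_nonneg _) (abs_nonneg _)
  · rw [← Finset.sum_mul]
    exact mul_le_mul_of_nonneg_right hB.sum_le (norm_nonneg _)

theorem le_alSmooth {κ : ℝ} (hB : P.UniformBound c κ) {β : ℝ} (hβ : 0 < β)
    (y : Vec l) (z : Vec m) {x : Vec n} (hx : x ∈ P.dom) :
    P.g x - ‖y‖ * κ - ‖z‖ ^ 2 / (2 * β) ≤ P.alSmooth β y z x := by
  have h1 : -(‖y‖ * κ) ≤ ⟪y, P.A x - P.b⟫ := by
    have := mul_le_mul_of_nonneg_left (hB.eq_le x hx) (norm_nonneg y)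
    have := (abs_le.1 (abs_real_inner_le_norm y (P.A x - P.b))).1
    linarith
  have h2 : 0 ≤ β / 2 * ‖P.A x - P.b‖ ^ 2 := by positivity
  have h3 : 0 ≤ 1 / (2 * β) * ‖pos (z + β • P.fvec x)‖ ^ 2 := by positivity
  have h4 : ‖z‖ ^ 2 / (2 * β) = 1 / (2 * β) * ‖z‖ ^ 2 := by ring
  rw [alSmooth, h4]
  linarith

theorem alSmooth_le {β : ℝ} (hβ : 0 < β) (y : Vec l) (z : Vec m) (x : Vec n) :
    P.alSmooth β y z x ≤ P.g x + (‖y‖ + ‖z‖) * P.residual x + β * P.residual x ^ 2 := by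
  have h1 : ⟪y, P.A x - P.b⟫ ≤ ‖y‖ * P.residual x :=
    (real_inner_le_norm _ _).trans
      (mul_le_mul_of_nonneg_left (P.norm_eq_le_residual x) (norm_nonneg _))
  have h2 : 1 / (2 * β) * (‖pos (z + β • P.fvec x)‖ ^ 2 - ‖z‖ ^ 2)
      ≤ ‖z‖ * P.residual x + β / 2 * ‖pos (P.fvec x)‖ ^ 2 := by
    have h3 := pow_le_pow_left₀ (norm_nonneg _) (norm_pos_add_le z (P.fvec x) hβ.le) 2
    calc 1 / (2 * β) * (‖pos (z + β • P.fvec x)‖ ^ 2 - ‖z‖ ^ 2)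
        ≤ 1 / (2 * β) * ((‖z‖ + β * ‖pos (P.fvec x)‖) ^ 2 - ‖z‖ ^ 2) :=
          mul_le_mul_of_nonneg_left (sub_le_sub_right h3 _) (by positivity)
      _ = ‖z‖ * ‖pos (P.fvec x)‖ + β / 2 * ‖pos (P.fvec x)‖ ^ 2 := by
          field_simp
          ring
      _ ≤ _ := add_le_add_left
          (mul_le_mul_of_nonneg_left (P.norm_ineq_le_residual x) (norm_nonneg _)) _
  have h3 : 0 ≤ β / 2 * ‖pos (P.fvec x)‖ ^ 2 := by positivity
  have h4 : 0 ≤ β / 2 * ‖P.A x - P.b‖ ^ 2 := by positivity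
  rw [alSmooth, residual_sq]
  linarith

/-- The regularity condition turns approximate stationarity into approximate feasibility. -/
theorem residual_le_of_regular (hP : P.Assumptions c) {κ : ℝ} (hB : P.UniformBound c κ) {β v ε : ℝ}
    (hβ : 0 < β) {y : Vec l} {z : Vec m} {x s : Vec n} (hs : s ∈ subdiff P.dom P.h x)
    (hst : ‖P.alGrad β y z x + s‖ ≤ ε)
    (hreg : ENNReal.ofReal (v * P.residual x) ≤
      Metric.infEDist (-(P.A.adjoint (P.A x - P.b)) - P.jacT x (pos (P.fvec x)))
        (β⁻¹ • subdiff P.dom P.h x)) :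
    v * (β * P.residual x) ≤ ε + κ + κ * ‖y‖ + κ * ‖z‖ := by
  have h1 := hreg.trans (Metric.infEDist_le_edist_of_mem (Set.smul_mem_smul_set (a := β⁻¹) hs))
  rw [edist_dist, ENNReal.ofReal_le_ofReal_iff dist_nonneg, dist_eq_norm] at h1
  have h2 := mul_le_mul_of_nonneg_left h1 hβ.le
  -- The β-sized parts of the augmented Lagrangian gradient cancel. What remains is bounded by the
  -- data and the multipliers, since [z + βf]_+ differs from β[f]_+ by at most ‖z‖.
  have e : β * ‖-(P.A.adjoint (P.A x - P.b)) - P.jacT x (pos (P.fvec x)) - β⁻¹ • s‖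
      = ‖gradient P.g x + P.A.adjoint y
        + P.jacT x (pos (z + β • P.fvec x) - β • pos (P.fvec x)) - (P.alGrad β y z x + s)‖ := by
    rw [← Real.norm_of_nonneg hβ.le, ← norm_smul, Real.norm_of_nonneg hβ.le]
    congr 1
    have hj : P.jacT x (pos (z + β • P.fvec x) - β • pos (P.fvec x))
        = P.jacT x (pos (z + β • P.fvec x)) - β • P.jacT x (pos (P.fvec x)) := by
      simp only [jacT, Finset.smul_sum, ← Finset.sum_sub_distrib]
      refine Finset.sum_congr rfl fun i _ => ?_
      rw [smul_smul, ← sub_smul]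
      rfl
    rw [hj, alGrad, smul_sub, smul_smul, mul_inv_cancel₀ hβ.ne', one_smul, map_add, map_smul]
    module
  rw [e] at h2
  have h3 : ‖gradient P.g x + P.A.adjoint y
        + P.jacT x (pos (z + β • P.fvec x) - β • pos (P.fvec x)) - (P.alGrad β y z x + s)‖
      ≤ κ + κ * ‖y‖ + κ * ‖z‖ + ε := by
    refine (norm_sub_le _ _).trans (add_le_add ((norm_add_le _ _).trans
      (add_le_add ((norm_add_le _ _).trans (add_le_add (hB.grad_le x hs.1) ?_)) ?_)) hst)
    · exact (P.A.adjoint.le_opNorm y).trans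
        (mul_le_mul_of_nonneg_right hB.adj_le (norm_nonneg _))
    · exact (norm_jacT_le hP hB hs.1 _).trans (mul_le_mul_of_nonneg_left
        (norm_pos_sub_le _ _ hβ.le) (zero_le_one.trans hB.one_le))
  linarith

/-- Approximate complementarity of a single constraint with the multiplier `[ζ + β φ]_+`. -/
theorem abs_max_mul_le {ζ β φ Z r : ℝ} (hζ : 0 ≤ ζ) (hζZ : ζ ≤ Z) (hβ : 0 < β)
    (hφ : max φ 0 ≤ r) : |max (ζ + β * φ) 0 * φ| ≤ Z * r + β * r ^ 2 + Z ^ 2 / β := by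
  have hr : 0 ≤ r := (le_max_right _ _).trans hφ
  have hφr : φ ≤ r := (le_max_left _ _).trans hφ
  have hZ : 0 ≤ Z := hζ.trans hζZ
  have h1 : 0 ≤ Z ^ 2 / β := by positivity
  rcases le_total 0 φ with h | h
  · rw [max_eq_left (by positivity), abs_of_nonneg (by positivity)]
    have : (ζ + β * φ) * φ ≤ (Z + β * r) * r := by gcongr
    linarith
  · have h2 : 0 ≤ Z * r + β * r ^ 2 := by positivity
    rw [abs_mul, abs_of_nonneg (le_max_right _ _), abs_of_nonpos h]
    suffices max (ζ + β * φ) 0 * -φ ≤ Z ^ 2 / β by linarith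
    -- For φ ≤ 0 the multiplier is positive only if β|φ| ≤ ζ, which makes the product O(Z²/β).
    rcases le_total (ζ + β * φ) 0 with h3 | h3
    · rw [max_eq_right h3, zero_mul]
      exact h1
    · rw [max_eq_left h3, le_div_iff₀ hβ]
      have h4 : ζ + β * φ ≤ Z := by nlinarith
      have h5 : -φ * β ≤ Z := by linarith
      have := mul_le_mul h4 h5 (mul_nonneg (neg_nonneg.2 h) hβ.le) hZ
      linarith

/-- The gradient of the augmented Lagrangian is that of the ordinary Lagrangian at the shifted
multipliers y + β(Ax - b) and [z + βf]_+, so stationarity transfers without loss. -/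
theorem isKKT_of_stationary {β ε : ℝ} (hβ : 0 < β) {y : Vec l} {z : Vec m}
    (hz : ∀ i, 0 ≤ z i) {x s : Vec n} (hs : s ∈ subdiff P.dom P.h x)
    (hst : ‖P.alGrad β y z x + s‖ ≤ ε) (hres : P.residual x ≤ ε)
    (hcomp : m * (‖z‖ * P.residual x + β * P.residual x ^ 2 + ‖z‖ ^ 2 / β) ≤ ε) :
    P.IsKKT ε x := by
  refine ⟨y + β • (P.A x - P.b), pos (z + β • P.fvec x), (P.norm_eq_le_residual x).trans hres,
    (P.norm_ineq_le_residual x).trans hres, fun i => le_max_right _ _, ?_, ?_⟩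
  · refine (Metric.infEDist_le_edist_of_mem (Set.mem_image_of_mem _ hs)).trans ?_
    rw [edist_dist, dist_eq_norm, zero_sub, norm_neg]
    refine ENNReal.ofReal_le_ofReal (le_trans (le_of_eq ?_) hst)
    rw [alGrad]
    congr 1
    abel
  · refine (Finset.sum_le_card_nsmul _ _
      (‖z‖ * P.residual x + β * P.residual x ^ 2 + ‖z‖ ^ 2 / β) fun i _ => ?_).trans
      (le_trans (le_of_eq (by simp [mul_add])) hcomp)
    refine abs_max_mul_le (hz i) ((le_abs_self _).trans (abs_apply_le_norm z i)) hβ ?_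
    have h1 := abs_apply_le_norm (pos (P.fvec x)) i
    exact ((le_abs_self _).trans h1).trans (P.norm_ineq_le_residual x)

theorem gam_nonneg (P : Problem n l m) (x0 : Vec n) (k : ℕ) : 0 ≤ P.gam x0 k := by
  have : 0 ≤ min ‖P.A x0 - P.b‖ ‖pos (P.fvec x0)‖ := le_min (norm_nonneg _) (norm_nonneg _)
  unfold gam
  positivity

theorem wstep_bounds (hP : P.Assumptions c) (x0 : Vec n) (k : ℕ) (x : Vec n) :
    0 ≤ P.wstep c x0 k x ∧ P.wstep c x0 k x ≤ c.w₀ ∧ P.wstep c x0 k x ≤ beta c k := by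
  have hw := hP.w_pos
  have hβ := beta_pos hP k
  have key : ∀ q : ℝ, 0 ≤ q → q ≤ 1 → 0 ≤ c.w₀ * min q (beta c k / c.w₀) ∧
      c.w₀ * min q (beta c k / c.w₀) ≤ c.w₀ ∧ c.w₀ * min q (beta c k / c.w₀) ≤ beta c k := by
    intro q h0 h1
    refine ⟨mul_nonneg hw.le (le_min h0 (by positivity)),
      mul_le_of_le_one_right hw.le ((min_le_left _ _).trans h1), ?_⟩
    have := mul_le_mul_of_nonneg_left (min_le_right q (beta c k / c.w₀)) hw.le
    rwa [mul_div_cancel₀ _ hw.ne'] at this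
  unfold wstep
  simp only
  split_ifs with h
  · exact key 1 zero_le_one le_rfl
  · exact key _ (le_min zero_le_one (div_nonneg (gam_nonneg P x0 k)
      (le_max_of_le_left (norm_nonneg _)))) (min_le_left _ _)

end Problem
end IALM

/-! ### Invariants and induction over the outer iterations. -/

namespace IALM
namespace Problem

variable {n l m : ℕ} {P : Problem n l m} {c : Params m}

/-- Constants controlling the outer iterations: `R` bounds the scaled residuals, `E` the penalty
terms and `I` the increase of the objective. -/
structure OuterConstants (P : Problem n l m) (c : Params m) (v : ℝ) (x0 : Vec n)
    (εmax κ R E I : ℝ) : Prop where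
  R_nonneg : 0 ≤ R
  R_init : c.β₀ * P.residual x0 ≤ R
  R_step : c.σ * (εmax + κ + 2 * c.w₀ * κ ^ 2) ≤ v * R
  E_ge : c.w₀ * κ ^ 2 + (c.w₀ * κ) ^ 2 / c.β₀ + 2 * c.w₀ * κ * R / c.β₀ + R ^ 2 / c.β₀ ≤ E
  I_ge : 2 * E + εmax ^ 2 / c.ρ₀ ≤ I

/-- The quantities controlled at the beginning of outer iteration `k`. -/
structure OuterInvariant (P : Problem n l m) (c : Params m) (x0 : Vec n) (κ R I : ℝ) (k : ℕ)
    (y : Vec l) (z : Vec m) (x : Vec n) : Prop where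
  mem : x ∈ P.dom
  y_le : ‖y‖ ≤ c.w₀ * κ * k
  z_nonneg : ∀ i, 0 ≤ z i
  z_le : ∀ i, z i ≤ c.w₀ * |c.Bf i| * k
  res_le : beta c k * P.residual x ≤ R * (k + 1)
  obj_le : P.g x + P.h x ≤ P.g x0 + P.h x0 + I * k * (k + 1) ^ 2

theorem beta_ge (hP : P.Assumptions c) (k : ℕ) : c.β₀ ≤ beta c k :=
  le_mul_of_one_le_right hP.beta_pos.le (one_le_pow₀ hP.sigma_gt.le)

namespace OuterInvariant

variable {v εmax κ R E I : ℝ} {x0 x : Vec n} {y : Vec l} {z : Vec m} {k : ℕ}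

theorem norm_z_le (h : P.OuterInvariant c x0 κ R I k y z x) (hP : P.Assumptions c)
    (hB : P.UniformBound c κ) : ‖z‖ ≤ c.w₀ * κ * k := by
  refine (norm_le_sum_abs z).trans ((?_ : _ ≤ ∑ i, c.w₀ * |c.Bf i| * k).trans ?_)
  · exact Finset.sum_le_sum fun i _ => by rw [abs_of_nonneg (h.z_nonneg i)]; exact h.z_le i
  · rw [← Finset.sum_mul, ← Finset.mul_sum]
    have := hB.sum_le
    have := hP.w_pos
    gcongr

theorem init (hx0 : x0 ∈ P.dom)
    (hC : P.OuterConstants c v x0 εmax κ R E I) : P.OuterInvariant c x0 κ R I 0 0 0 x0 where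
  mem := hx0
  y_le := by simp
  z_nonneg i := le_rfl
  z_le i := by simp
  res_le := by simpa [beta] using hC.R_init
  obj_le := by simp

theorem penalty_ge (h : P.OuterInvariant c x0 κ R I k y z x) (hP : P.Assumptions c)
    (hB : P.UniformBound c κ) (hC : P.OuterConstants c v x0 εmax κ R E I) {u : Vec n}
    (hu : u ∈ P.dom) : P.g u - E * (k + 1) ^ 2 ≤ P.alSmooth (beta c k) y z u := by
  have h1 := le_alSmooth hB (beta_pos hP k) y z hu
  have hβ := hP.beta_pos
  have hw := hP.w_pos
  have hκ := zero_le_one.trans hB.one_le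
  have hk : (0 : ℝ) ≤ k := Nat.cast_nonneg k
  have hR := hC.R_nonneg
  have h2 : ‖y‖ * κ ≤ c.w₀ * κ ^ 2 * (k + 1) ^ 2 := by
    have : ‖y‖ * κ ≤ c.w₀ * κ * k * κ := mul_le_mul_of_nonneg_right h.y_le hκ
    have h3 : c.w₀ * κ ^ 2 * k ≤ c.w₀ * κ ^ 2 * (k + 1) ^ 2 :=
      mul_le_mul_of_nonneg_left (by nlinarith) (by positivity)
    linarith
  have h3 : ‖z‖ ^ 2 / (2 * beta c k) ≤ (c.w₀ * κ) ^ 2 / c.β₀ * (k + 1) ^ 2 := by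
    have h4 : ‖z‖ ≤ c.w₀ * κ * (k + 1) := (h.norm_z_le hP hB).trans (by gcongr; linarith)
    have h5 : c.β₀ ≤ 2 * beta c k := by linarith [beta_ge hP k]
    calc ‖z‖ ^ 2 / (2 * beta c k) ≤ (c.w₀ * κ * (k + 1)) ^ 2 / c.β₀ := by gcongr
      _ = _ := by ring
  have h4 : 0 ≤ (2 * c.w₀ * κ * R / c.β₀ + R ^ 2 / c.β₀) * (k + 1) ^ 2 := by positivity
  have h5 := mul_le_mul_of_nonneg_right hC.E_ge (sq_nonneg ((k : ℝ) + 1))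
  linarith

/-- The dangerous term β_k · residual² is the product of β_k · residual ≤ R(k+1) and residual ≤
R(k+1)/β₀, so no power of β_k survives. -/
theorem penalty_le (h : P.OuterInvariant c x0 κ R I k y z x) (hP : P.Assumptions c)
    (hB : P.UniformBound c κ) (hC : P.OuterConstants c v x0 εmax κ R E I) :
    P.alSmooth (beta c k) y z x ≤ P.g x + E * (k + 1) ^ 2 := by
  have h1 := P.alSmooth_le (beta_pos hP k) y z x
  have hβ := hP.beta_pos
  have hβk := beta_ge hP k
  have hw := hP.w_pos
  have hκ := zero_le_one.trans hB.one_le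
  have hk : (0 : ℝ) ≤ k := Nat.cast_nonneg k
  have hR := hC.R_nonneg
  have hr := P.residual_nonneg x
  have h2 : P.residual x ≤ R * (k + 1) / c.β₀ := by
    rw [le_div_iff₀ hβ]
    nlinarith [h.res_le]
  have h3 : (‖y‖ + ‖z‖) * P.residual x ≤ 2 * c.w₀ * κ * R / c.β₀ * (k + 1) ^ 2 := by
    have h4 : ‖y‖ + ‖z‖ ≤ 2 * c.w₀ * κ * (k + 1) := by
      have := h.y_le
      have := h.norm_z_le hP hB
      have : 0 ≤ c.w₀ * κ := by positivity
      linarith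
    calc (‖y‖ + ‖z‖) * P.residual x ≤ (2 * c.w₀ * κ * (k + 1)) * (R * (k + 1) / c.β₀) := by gcongr
      _ = _ := by ring
  have h4 : beta c k * P.residual x ^ 2 ≤ R ^ 2 / c.β₀ * (k + 1) ^ 2 := by
    calc beta c k * P.residual x ^ 2 = (beta c k * P.residual x) * P.residual x := by ring
      _ ≤ (R * (k + 1)) * (R * (k + 1) / c.β₀) :=
        mul_le_mul h.res_le h2 hr (by positivity)
      _ = _ := by ring
  have h5 : 0 ≤ (c.w₀ * κ ^ 2 + (c.w₀ * κ) ^ 2 / c.β₀) * (k + 1) ^ 2 := by positivity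
  have h6 := mul_le_mul_of_nonneg_right hC.E_ge (sq_nonneg ((k : ℝ) + 1))
  linarith

/-- The subtracted quantity is a lower bound of the augmented Lagrangian over the domain, from g, h
≥ -κ and `penalty_ge`. This gap fixes the number of proximal point steps. -/
theorem gap_le (h : P.OuterInvariant c x0 κ R I k y z x) (hP : P.Assumptions c)
    (hB : P.UniformBound c κ) (hC : P.OuterConstants c v x0 εmax κ R E I) :
    P.alSmooth (beta c k) y z x + P.h x - (-(2 * κ) - E * (k + 1) ^ 2)
      ≤ (|P.g x0 + P.h x0| + 2 * κ + I + 2 * E) * (k + 1) ^ 3 := by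
  have h1 := h.penalty_le hP hB hC
  have h2 := h.obj_le
  have hβ := hP.beta_pos
  have hρ := hP.rho_pos
  have hw := hP.w_pos
  have hκ := zero_le_one.trans hB.one_le
  have hk : (0 : ℝ) ≤ k := Nat.cast_nonneg k
  have hR := hC.R_nonneg
  have hE : 0 ≤ E := le_trans (by positivity) hC.E_ge
  have hI : 0 ≤ I := le_trans (by positivity) hC.I_ge
  have a1 : (1 : ℝ) ≤ (k + 1) ^ 3 := one_le_pow₀ (by linarith)
  have a2 : ((k : ℝ) + 1) ^ 2 ≤ (k + 1) ^ 3 := pow_le_pow_right₀ (by linarith) (by norm_num)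
  have a3 : k * ((k : ℝ) + 1) ^ 2 ≤ (k + 1) ^ 3 := by
    have := sq_nonneg ((k : ℝ) + 1)
    linarith [pow_succ ((k : ℝ) + 1) 2]
  have b1 := mul_le_mul_of_nonneg_left a1 (add_nonneg (abs_nonneg (P.g x0 + P.h x0))
    (mul_nonneg zero_le_two hκ))
  have b2 := mul_le_mul_of_nonneg_left a2 (mul_nonneg zero_le_two hE)
  have b3 := mul_le_mul_of_nonneg_left a3 hI
  have b4 := le_abs_self (P.g x0 + P.h x0)
  linarith

theorem Lhat_le (h : P.OuterInvariant c x0 κ R I k y z x) (hP : P.Assumptions c) :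
    P.Lhat c k z + 2 * c.ρ₀ ≤ ((|c.L₀| + 2 * c.ρ₀ + ∑ i, |c.Lf i| * (c.w₀ * |c.Bf i|)) / c.β₀
      + ‖P.A.adjoint ∘L P.A‖ + ∑ i, |c.Bf i * (c.Bf i + c.Lf i)|) * (k + 1) * beta c k := by
  have hβ := hP.beta_pos
  have hβk := beta_ge hP k
  have hβk0 := beta_pos hP k
  have hw := hP.w_pos
  have hρ := hP.rho_pos
  have hk : (0 : ℝ) ≤ k := Nat.cast_nonneg k
  have key : ∀ q : ℝ, 0 ≤ q → q ≤ q / c.β₀ * beta c k := fun q hq => by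
    rw [div_mul_eq_mul_div, le_div_iff₀ hβ]
    exact mul_le_mul_of_nonneg_left hβk hq
  have key' : ∀ q : ℝ, 0 ≤ q → q ≤ q * (k + 1) := fun q hq =>
    le_mul_of_one_le_right hq (by linarith)
  have h1 : ∑ i, (beta c k * c.Bf i * (c.Bf i + c.Lf i) + c.Lf i * |z i|)
      ≤ beta c k * ∑ i, |c.Bf i * (c.Bf i + c.Lf i)|
        + (∑ i, |c.Lf i| * (c.w₀ * |c.Bf i|)) * (k + 1) := by
    rw [Finset.mul_sum, Finset.sum_mul, ← Finset.sum_add_distrib]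
    refine Finset.sum_le_sum fun i _ => add_le_add ?_ ?_
    · rw [mul_assoc]
      exact mul_le_mul_of_nonneg_left (le_abs_self _) hβk0.le
    · rw [abs_of_nonneg (h.z_nonneg i), mul_assoc]
      refine mul_le_mul (le_abs_self _) ((h.z_le i).trans ?_) (h.z_nonneg i) (abs_nonneg _)
      have : 0 ≤ c.w₀ * |c.Bf i| := by positivity
      linarith
  set S1 := ∑ i, |c.Lf i| * (c.w₀ * |c.Bf i|)
  set S2 := ∑ i, |c.Bf i * (c.Bf i + c.Lf i)|
  have hS1 : 0 ≤ S1 := Finset.sum_nonneg fun i _ => by positivity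
  have hS2 : 0 ≤ S2 := Finset.sum_nonneg fun i _ => by positivity
  have h2 := key (|c.L₀| + 2 * c.ρ₀) (by positivity)
  have h3 := key' _ ((by positivity : 0 ≤ (|c.L₀| + 2 * c.ρ₀)).trans h2)
  have h4 := mul_le_mul_of_nonneg_right (key S1 hS1) (by positivity : 0 ≤ (k : ℝ) + 1)
  have h5 := key' (beta c k * S2) (by positivity)
  have h6 := key' (beta c k * ‖P.A.adjoint ∘L P.A‖) (by positivity)
  have h7 := le_abs_self c.L₀
  have e : ((|c.L₀| + 2 * c.ρ₀ + S1) / c.β₀ + ‖P.A.adjoint ∘L P.A‖ + S2) * (k + 1) * beta c k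
      = (|c.L₀| + 2 * c.ρ₀) / c.β₀ * beta c k * (k + 1) + S1 / c.β₀ * beta c k * (k + 1)
        + beta c k * ‖P.A.adjoint ∘L P.A‖ * (k + 1) + beta c k * S2 * (k + 1) := by ring
  rw [e, Lhat]
  linarith

/-- The invariant is preserved by an outer iteration. -/
theorem next (h : P.OuterInvariant c x0 κ R I k y z x) (hP : P.Assumptions c)
    (hB : P.UniformBound c κ) (hC : P.OuterConstants c v x0 εmax κ R E I) (hv : 0 < v) {ε : ℝ}
    (hε : 0 < ε) (hε' : ε ≤ εmax) {u : Vec n} (hu : u ∈ P.dom)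
    (hst : ∃ s ∈ subdiff P.dom P.h u, ‖P.alGrad (beta c k) y z u + s‖ ≤ ε)
    (hdec : P.alSmooth (beta c k) y z u + P.h u
      ≤ P.alSmooth (beta c k) y z x + P.h x + ε ^ 2 / c.ρ₀)
    (hreg : ENNReal.ofReal (v * P.residual u) ≤
      Metric.infEDist (-(P.A.adjoint (P.A u - P.b)) - P.jacT u (pos (P.fvec u)))
        ((beta c k)⁻¹ • subdiff P.dom P.h u)) :
    beta c k * P.residual u ≤ R * (k + 1) ∧
    P.OuterInvariant c x0 κ R I (k + 1) (P.newY c x0 k y u) (P.newZ c x0 k z u) u := by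
  obtain ⟨s, hs, hst⟩ := hst
  have hβ := hP.beta_pos
  have hβk := beta_pos hP k
  have hw := hP.w_pos
  have hρ := hP.rho_pos
  have hσ := hP.sigma_gt
  have hk : (0 : ℝ) ≤ k := Nat.cast_nonneg k
  have hκ := zero_le_one.trans hB.one_le
  have hr := P.residual_nonneg u
  -- The factor σ is built into `R_step` because the next invariant measures the same residual with
  -- β_{k+1} = σβ_k.
  have hσr : c.σ * (beta c k * P.residual u) ≤ R * (k + 1) := by
    have h1 := residual_le_of_regular hP hB hβk hs hst hreg
    have h2 := h.y_le
    have h3 := h.norm_z_le hP hB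
    have h4 : v * (beta c k * P.residual u) ≤ (εmax + κ + 2 * c.w₀ * κ ^ 2) * (k + 1) := by
      have a1 := mul_le_mul_of_nonneg_left h2 hκ
      have a2 := mul_le_mul_of_nonneg_left h3 hκ
      have a3 : 0 ≤ c.w₀ * κ ^ 2 := by positivity
      have a4 : 0 ≤ (εmax + κ) * k := mul_nonneg (by linarith) hk
      linarith
    have h5 := mul_le_mul_of_nonneg_left h4 (zero_le_one.trans hσ.le)
    have h6 := mul_le_mul_of_nonneg_right hC.R_step (by positivity : 0 ≤ (k : ℝ) + 1)
    refine le_of_mul_le_mul_left ?_ hv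
    linarith
  have hr0 : 0 ≤ beta c k * P.residual u := mul_nonneg hβk.le hr
  obtain ⟨w0, w1, w2⟩ := wstep_bounds hP x0 k u
  have hR := hC.R_nonneg
  have hE : 0 ≤ E := le_trans (by positivity) hC.E_ge
  have hI : 0 ≤ I := le_trans (by positivity) hC.I_ge
  refine ⟨by nlinarith, hu, ?_, fun i => ?_, fun i => ?_, ?_, ?_⟩
  · refine (norm_add_le _ _).trans ?_
    rw [norm_smul, Real.norm_of_nonneg w0]
    have := mul_le_mul w1 (hB.eq_le u hu) (norm_nonneg _) hw.le
    have := h.y_le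
    push_cast
    linarith
  · change 0 ≤ z i + P.wstep c x0 k u * max (-(z i / beta c k)) (P.f i u)
    -- The new multiplier is at least z_i(1 - w_k/β_k), which is nonnegative because w_k ≤ β_k.
    have h1 := mul_le_mul_of_nonneg_left (le_max_left (-(z i / beta c k)) (P.f i u)) w0
    have h2 := mul_le_mul_of_nonneg_right w2 (div_nonneg (h.z_nonneg i) hβk.le)
    rw [mul_div_cancel₀ _ hβk.ne'] at h2
    linarith
  · change z i + P.wstep c x0 k u * max (-(z i / beta c k)) (P.f i u) ≤ _
    have h1 : max (-(z i / beta c k)) (P.f i u) ≤ |c.Bf i| :=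
      max_le ((neg_nonpos.2 (div_nonneg (h.z_nonneg i) hβk.le)).trans (abs_nonneg _))
        ((le_abs_self _).trans ((abs_f_le hP i (dom_subset_extDom P hu)).trans (le_abs_self _)))
    have h2 := mul_le_mul_of_nonneg_left h1 w0
    have h3 := mul_le_mul_of_nonneg_right w1 (abs_nonneg (c.Bf i))
    have h4 := h.z_le i
    push_cast
    linarith
  · have e : beta c (k + 1) = c.σ * beta c k := by rw [beta, beta]; ring
    rw [e, mul_assoc]
    push_cast
    linarith
  -- Passing from g + h to the augmented Lagrangian and back costs E(k+1)² each way, and the inexact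
  -- descent at most ε²/ρ₀.
  · have h1 := h.penalty_ge hP hB hC hu
    have h2 := h.penalty_le hP hB hC
    have h3 := h.obj_le
    have h4 : ε ^ 2 / c.ρ₀ ≤ εmax ^ 2 / c.ρ₀ := by gcongr
    have h5 : I * (k + 1) * (k + 1) ^ 2 ≤ I * (k + 1) * (k + 1 + 1) ^ 2 := by
      gcongr
      linarith
    have h6 : (1 : ℝ) ≤ (k + 1) ^ 2 := one_le_pow₀ (by linarith)
    have h7 : 0 ≤ εmax ^ 2 / c.ρ₀ := by positivity
    have h8 := mul_le_mul_of_nonneg_right hC.I_ge (sq_nonneg ((k : ℝ) + 1))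
    have h9 := mul_le_mul_of_nonneg_left h6 h7
    push_cast
    linarith

end OuterInvariant

/-- The constant in the bound `Λ (k + 1) β_k` for the smoothness constants. -/
noncomputable def lipConst (P : Problem n l m) (c : Params m) : ℝ :=
  (|c.L₀| + 2 * c.ρ₀ + ∑ i, |c.Lf i| * (c.w₀ * |c.Bf i|)) / c.β₀
      + ‖P.A.adjoint ∘L P.A‖ + ∑ i, |c.Bf i * (c.Bf i + c.Lf i)|

theorem lipConst_pos (hP : P.Assumptions c) : 0 < P.lipConst c := by
  have hβ := hP.beta_pos
  have hw := hP.w_pos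
  have hρ := hP.rho_pos
  have hS1 : 0 ≤ ∑ i, |c.Lf i| * (c.w₀ * |c.Bf i|) := Finset.sum_nonneg fun i _ => by positivity
  have hS2 : 0 ≤ ∑ i, |c.Bf i * (c.Bf i + c.Lf i)| := Finset.sum_nonneg fun i _ => by positivity
  unfold lipConst
  positivity

theorem startCall_k (y : Vec l) (z : Vec m) (k : ℕ) (center xm' : Vec n) :
    (P.startCall c k y z center xm').k = k := rfl

theorem startCall_center (y : Vec l) (z : Vec m) (k : ℕ) (center xm' : Vec n) :
    (P.startCall c k y z center xm').center = center := rfl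

/-- One outer iteration within the run of the method. -/
theorem run_outer (hP : P.Assumptions c) {v εmax κ R E I ε : ℝ} {x0 : Vec n} {xm : ℕ → Vec n}
    (hB : P.UniformBound c κ) (hC : P.OuterConstants c v x0 εmax κ R E I) (hv : 0 < v)
    (hε : 0 < ε) (hε' : ε ≤ εmax) (hxm : ∀ N, xm N ∈ P.dom)
    (hreg : P.Regular c v (P.run c ε x0 xm)) {k N₀ : ℕ} {y : Vec l} {z : Vec m} {x xm' : Vec n}
    (hinv : P.OuterInvariant c x0 κ R I k y z x) (hxm' : xm' ∈ P.dom)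
    (h0 : P.run c ε x0 xm N₀ = P.startCall c k y z x xm') {W Lb : ℝ} {J : ℕ}
    (hLb : P.lipConst c * (k + 1) * beta c k ≤ Lb)
    (hW : √(Lb / c.ρ₀) * Real.log (1 + 256 * Lb ^ 3 * κ ^ 2 / (c.ρ₀ * ε ^ 2)) + 1 ≤ W)
    (hJ : (|P.g x0 + P.h x0| + 2 * κ + I + 2 * E) * (k + 1) ^ 3
      < (J + 1) * (ε ^ 2 / (96 * c.ρ₀))) :
    ∃ (N : ℕ) (u : Vec n), (N : ℝ) ≤ N₀ + (J + 1) * (W + 1) ∧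
      Produces (P.run c ε x0 xm) N (k + 1) u ∧
      (∃ s ∈ subdiff P.dom P.h u, ‖P.alGrad (beta c k) y z u + s‖ ≤ ε) ∧
      beta c k * P.residual u ≤ R * (k + 1) ∧
      P.OuterInvariant c x0 κ R I (k + 1) (P.newY c x0 k y u) (P.newZ c x0 k z u) u ∧
      P.run c ε x0 xm N
        = P.startCall c (k + 1) (P.newY c x0 k y u) (P.newZ c x0 k z u) u (xm N) := by
  have hβk := beta_pos hP k
  have hLb0 : 0 < Lb :=
    (mul_pos (mul_pos (lipConst_pos hP) (by positivity)) hβk).trans_le hLb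
  have hapg := fun center xm' (h : xm' ∈ P.dom) => exists_apgTest_subG hP hB.diam_le hε k y z hLb0
    ((hinv.Lhat_le hP).trans hLb) center h
  obtain ⟨N, hN, u, hu, hst, hdec, hk, hrun⟩ := run_prox hP hε (x0 := x0) hxm (W := W)
    (μ₀ := -(2 * κ) - E * (k + 1) ^ 2)
    (fun center xm' h => (hapg center xm' h).1)
    (fun center xm' h => (hapg center xm' h).2.imp fun t ht => ⟨ht.1.trans hW, ht.2⟩)
    (fun w hw => by
      have h1 := hinv.penalty_ge hP hB hC hw
      have h2 := hB.h_ge w hw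
      have h3 := (abs_le.1 (hB.g_le w hw)).1
      linarith) J N₀ x xm' hinv.mem hxm' h0 ((hinv.gap_le hP hB hC).trans_lt hJ)
  have hprod : Produces (P.run c ε x0 xm) (N + 1) (k + 1) u :=
    ⟨N, rfl, by rw [hk], by rw [hrun, startCall_k], by rw [hrun, startCall_center]⟩
  have hregu := hreg _ _ _ hprod
  rw [Nat.add_sub_cancel] at hregu
  obtain ⟨hres, hnext⟩ := hinv.next hP hB hC hv hε hε' hu hst hdec hregu
  exact ⟨N + 1, u, hN, hprod, hst, hres, hnext, hrun⟩

/-- The run of the method up to and including outer iteration `K`, under bounds that are uniform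
over the outer iterations. -/
theorem exists_kkt_of_bounds (hP : P.Assumptions c) {v εmax κ R E I ε : ℝ} {x0 : Vec n}
    {xm : ℕ → Vec n} (hx0 : x0 ∈ P.dom)
    (hB : P.UniformBound c κ) (hC : P.OuterConstants c v x0 εmax κ R E I) (hv : 0 < v)
    (hε : 0 < ε) (hε' : ε ≤ εmax) (hxm : ∀ N, xm N ∈ P.dom)
    (hreg : P.Regular c v (P.run c ε x0 xm)) {K : ℕ}
    (hK : (R + m * (c.w₀ * κ * R + R ^ 2 + (c.w₀ * κ) ^ 2)) * (K + 1) ^ 2 ≤ ε * beta c K)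
    {W Lb : ℝ} {J : ℕ} (hLb : P.lipConst c * (K + 1) * beta c K ≤ Lb)
    (hW : √(Lb / c.ρ₀) * Real.log (1 + 256 * Lb ^ 3 * κ ^ 2 / (c.ρ₀ * ε ^ 2)) + 1 ≤ W)
    (hJ : (|P.g x0 + P.h x0| + 2 * κ + I + 2 * E) * (K + 1) ^ 3
      < (J + 1) * (ε ^ 2 / (96 * c.ρ₀))) :
    ∃ (N k : ℕ) (x : Vec n), Produces (P.run c ε x0 xm) N k x ∧ P.IsKKT ε x ∧
      (N : ℝ) ≤ (K + 1) * ((J + 1) * (W + 1)) := by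
  have hβ := hP.beta_pos
  have hρ := hP.rho_pos
  have hw := hP.w_pos
  have hκ := zero_le_one.trans hB.one_le
  have hR := hC.R_nonneg
  have hE : 0 ≤ E := le_trans (by positivity) hC.E_ge
  have hI : 0 ≤ I := le_trans (by positivity) hC.I_ge
  have hΛ := (lipConst_pos hP).le
  have hmono : ∀ k ≤ K, P.lipConst c * (k + 1) * beta c k ≤ Lb ∧
      (|P.g x0 + P.h x0| + 2 * κ + I + 2 * E) * ((k : ℝ) + 1) ^ 3
        < (J + 1) * (ε ^ 2 / (96 * c.ρ₀)) := by
    intro k hk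
    have hk' : (k : ℝ) ≤ K := Nat.cast_le.2 hk
    have hbeta : beta c k ≤ beta c K :=
      mul_le_mul_of_nonneg_left (pow_le_pow_right₀ hP.sigma_gt.le hk) hβ.le
    have := (beta_pos hP k).le
    exact ⟨le_trans (by gcongr) hLb, lt_of_le_of_lt (by gcongr) hJ⟩
  have hstart : ∀ k ≤ K, ∃ (N : ℕ) (y : Vec l) (z : Vec m) (x xm' : Vec n),
      (N : ℝ) ≤ k * ((J + 1) * (W + 1)) ∧ P.OuterInvariant c x0 κ R I k y z x ∧ xm' ∈ P.dom ∧
      P.run c ε x0 xm N = P.startCall c k y z x xm' := by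
    intro k
    induction k with
    | zero =>
      exact fun _ => ⟨0, 0, 0, x0, xm 0, by simp, OuterInvariant.init hx0 hC, hxm 0, rfl⟩
    | succ k ih =>
      intro hk
      obtain ⟨N, y, z, x, xm', hN, hinv, hxm', hrun⟩ := ih (Nat.le_of_succ_le hk)
      obtain ⟨h1, h2⟩ := hmono k (Nat.le_of_succ_le hk)
      obtain ⟨N', u, hN', -, -, -, hinv', hrun'⟩ :=
        run_outer hP hB hC hv hε hε' hxm hreg hinv hxm' hrun h1 hW h2
      exact ⟨N', _, _, u, xm N', by push_cast; linarith, hinv', hxm _, hrun'⟩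
  obtain ⟨N, y, z, x, xm', hN, hinv, hxm', hrun⟩ := hstart K le_rfl
  -- Outer iteration K produces x^{K+1}; its certificate uses the multipliers and the penalty from
  -- the start of that iteration.
  obtain ⟨N', u, hN', hprod, ⟨s, hs, hst⟩, hres, -, -⟩ :=
    run_outer hP hB hC hv hε hε' hxm hreg hinv hxm' hrun hLb hW hJ
  refine ⟨N', K + 1, u, hprod, ?_, by linarith⟩
  have hβK := beta_pos hP K
  have hr := P.residual_nonneg u
  have hK1 : (1 : ℝ) ≤ K + 1 := by simp
  have hZ : ‖z‖ ≤ c.w₀ * κ * (K + 1) := (hinv.norm_z_le hP hB).trans (by gcongr; linarith)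
  have hsq : ((K : ℝ) + 1) ≤ (K + 1) ^ 2 := by nlinarith
  have hS : 0 ≤ (m : ℝ) * (c.w₀ * κ * R + R ^ 2 + (c.w₀ * κ) ^ 2) := by positivity
  refine isKKT_of_stationary hβK hinv.z_nonneg hs hst ?_ ?_
  · refine le_of_mul_le_mul_left ?_ hβK
    have h1 := mul_le_mul_of_nonneg_left hsq hR
    have h2 := mul_nonneg hS (sq_nonneg ((K : ℝ) + 1))
    linarith
  · refine le_of_mul_le_mul_left ?_ hβK
    have h1 : beta c K * (m * (‖z‖ * P.residual u + beta c K * P.residual u ^ 2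
        + ‖z‖ ^ 2 / beta c K))
        = m * (‖z‖ * (beta c K * P.residual u) + (beta c K * P.residual u) ^ 2 + ‖z‖ ^ 2) := by
      field_simp
    rw [h1]
    have h2 : m * (‖z‖ * (beta c K * P.residual u) + (beta c K * P.residual u) ^ 2 + ‖z‖ ^ 2)
        ≤ m * ((c.w₀ * κ * (K + 1)) * (R * (K + 1)) + (R * (K + 1)) ^ 2
          + (c.w₀ * κ * (K + 1)) ^ 2) := by
      have : 0 ≤ beta c K * P.residual u := mul_nonneg hβK.le hr
      gcongr
    have h3 := mul_nonneg hR (sq_nonneg ((K : ℝ) + 1))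
    linarith

end Problem
end IALM

/-! ### Choice of the last outer iteration and the final count. -/

namespace IALM

theorem exists_sq_le_mul_pow {τ : ℝ} (hτ : 1 < τ) :
    ∃ B : ℝ, 0 < B ∧ ∀ k : ℕ, ((k : ℝ) + 1) ^ 2 ≤ B * τ ^ k := by
  obtain ⟨C, hC⟩ := (tendsto_pow_const_div_const_pow_of_one_lt 2 hτ).bddAbove_range
  have hτ0 : 0 < τ := zero_lt_one.trans hτ
  have h : ∀ k : ℕ, ((k : ℝ) + 1) ^ 2 ≤ C * τ * τ ^ k := fun k => by
    have h1 := hC (Set.mem_range_self (k + 1))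
    simp only [Nat.cast_add, Nat.cast_one] at h1
    rw [div_le_iff₀ (pow_pos hτ0 _), pow_succ τ] at h1
    linarith
  refine ⟨C * τ, ?_, h⟩
  have h0 := h 0
  norm_num at h0
  linarith

/-- The number of outer iterations after which the penalty parameter is large enough. -/
theorem exists_outer_index {σ β₀ A εmax : ℝ} (hσ : 1 < σ) (hβ : 0 < β₀) (hA : 0 < A) :
    ∃ a : ℝ, 1 ≤ a ∧ ∀ ε : ℝ, 0 < ε → ε ≤ εmax → ∃ K : ℕ,
      A * ((K : ℝ) + 1) ^ 2 ≤ ε * (β₀ * σ ^ K) ∧ β₀ * σ ^ K ≤ a * ((K : ℝ) + 1) ^ 2 / ε ∧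
      (K : ℝ) + 1 ≤ a * (1 + |Real.log ε|) := by
  have hσ0 : 0 < σ := zero_lt_one.trans hσ
  have hτ : 1 < √σ := Real.lt_sqrt_of_sq_lt (by simpa using hσ)
  have hτ0 := zero_lt_one.trans hτ
  have hτσ : ∀ k : ℕ, σ ^ k = √σ ^ k * √σ ^ k := fun k => by
    rw [← mul_pow, Real.mul_self_sqrt hσ0.le]
  have hlogτ := Real.log_pos hτ
  obtain ⟨B, hB, hBk⟩ := exists_sq_le_mul_pow hτ
  set a₀ := |β₀ * εmax| + σ * A + 1 with ha₀
  have ha₀1 : 1 ≤ a₀ := by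
    have := abs_nonneg (β₀ * εmax)
    have := mul_pos hσ0 hA
    linarith
  set q := (1 + |Real.log (a₀ * B / β₀)|) / Real.log √σ with hq
  have hq0 : 0 ≤ q := by positivity
  refine ⟨a₀ + q, by linarith, fun ε hε hε' => ?_⟩
  have hex : ∃ K : ℕ, A * ((K : ℝ) + 1) ^ 2 ≤ ε * (β₀ * σ ^ K) := by
    obtain ⟨K, hK⟩ := pow_unbounded_of_one_lt (A * B / (ε * β₀)) hτ
    refine ⟨K, ?_⟩
    rw [div_lt_iff₀ (by positivity)] at hK
    have h1 := mul_le_mul_of_nonneg_left (hBk K) hA.le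
    have h2 := mul_le_mul_of_nonneg_right hK.le (pow_pos hτ0 K).le
    rw [hτσ]
    linarith
  -- The least admissible K is taken: failure at K - 1 bounds β_K from above. Writing σ^K = √σ^K ·
  -- √σ^K, one factor absorbs (K+1)² and the other bounds K by a logarithm.
  classical
  have hspec := Nat.find_spec hex
  have hmin : ∀ j < Nat.find hex, ¬ A * ((j : ℝ) + 1) ^ 2 ≤ ε * (β₀ * σ ^ j) :=
    fun j hj => Nat.find_min hex hj
  set K := Nat.find hex
  have hβK : β₀ * σ ^ K ≤ a₀ * ((K : ℝ) + 1) ^ 2 / ε := by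
    rw [le_div_iff₀ hε]
    have hsq : (0 : ℝ) ≤ ((K : ℝ) + 1) ^ 2 := by positivity
    have hσA : 0 ≤ σ * A := (mul_pos hσ0 hA).le
    rcases hK : K with _ | j
    · have h1 := mul_le_mul_of_nonneg_left hε' hβ.le
      have h2 := le_abs_self (β₀ * εmax)
      simp only [pow_zero, mul_one, Nat.cast_zero, zero_add, one_pow]
      linarith
    · have h1 := not_le.1 (hmin j (by omega))
      have hj : (0 : ℝ) ≤ j := Nat.cast_nonneg j
      have h2 : ((j : ℝ) + 1) ^ 2 ≤ ((j + 1 : ℕ) + 1 : ℝ) ^ 2 := by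
        push_cast
        gcongr
        linarith
      have h3 := mul_le_mul_of_nonneg_left h1.le hσ0.le
      have h4 := mul_le_mul_of_nonneg_left h2 hσA
      have h5 : 0 ≤ (|β₀ * εmax| + 1) * ((j + 1 : ℕ) + 1 : ℝ) ^ 2 := by positivity
      rw [pow_succ]
      linarith
  refine ⟨K, hspec, hβK.trans ?_, ?_⟩
  · gcongr
    linarith
  · have h1 : √σ ^ K ≤ a₀ * B / β₀ / ε := by
      have h2 := hβK.trans (div_le_div_of_nonneg_right
        (mul_le_mul_of_nonneg_left (hBk K) (zero_le_one.trans ha₀1)) hε.le)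
      have hpow := pow_pos hτ0 K
      rw [hτσ] at h2
      refine le_of_mul_le_mul_left ?_ (mul_pos hβ hpow)
      calc β₀ * √σ ^ K * √σ ^ K = β₀ * (√σ ^ K * √σ ^ K) := by ring
        _ ≤ _ := h2
        _ = _ := by field_simp
    have h3 := Real.log_le_log (pow_pos hτ0 K) h1
    have hpos : 0 < a₀ * B / β₀ := by positivity
    rw [Real.log_pow, Real.log_div hpos.ne' hε.ne'] at h3
    have h4 := le_abs_self (Real.log (a₀ * B / β₀))
    have h5 := neg_abs_le (Real.log ε)
    have hl := abs_nonneg (Real.log ε)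
    have hl' := abs_nonneg (Real.log (a₀ * B / β₀))
    have h6 : (K : ℝ) ≤ q * (1 + |Real.log ε|) := by
      rw [hq, div_mul_eq_mul_div, le_div_iff₀ hlogτ]
      have := mul_nonneg hl' hl
      linarith
    have h7 := mul_nonneg (zero_le_one.trans ha₀1) hl
    linarith

theorem rpow_neg_five_halves {ε : ℝ} (hε : 0 < ε) :
    ε ^ (-(5 / 2 : ℝ)) = (ε ^ 2)⁻¹ * (√ε)⁻¹ := by
  have e : -(5 / 2 : ℝ) = -(2 : ℝ) + -(1 / 2 : ℝ) := by norm_num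
  rw [e, Real.rpow_add hε, Real.rpow_neg hε.le, Real.rpow_neg hε.le, Real.rpow_two,
    Real.sqrt_eq_rpow]

/-- The argument is that of the APG bound for a smoothness constant of order ℓ⁴/ε, ℓ = 1 + |log ε|:
its cube divided by ε² gives ℓ^12/ε⁵. The exponents 12 and 5 add up to 17. -/
theorem log_one_add_le {d ε : ℝ} (hd : 0 ≤ d) (hε : 0 < ε) :
    Real.log (1 + d * ((1 + |Real.log ε|) ^ 12 / ε ^ 5)) ≤ (d + 17) * (1 + |Real.log ε|) := by
  have hl := abs_nonneg (Real.log ε)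
  set ℓ := 1 + |Real.log ε| with hℓ
  have hℓ1 : 1 ≤ ℓ := by linarith
  have hℓ0 : 0 < ℓ := by linarith
  have h1 : 1 / ε ^ 5 ≤ Real.exp (5 * |Real.log ε|) := by
    have h2 : 1 / ε ^ 5 = Real.exp (-(5 * Real.log ε)) := by
      have : Real.exp (5 * Real.log ε) = ε ^ 5 := by
        rw [← Real.exp_log (pow_pos hε 5), Real.log_pow]
        norm_num
      rw [Real.exp_neg, this, one_div]
    rw [h2, Real.exp_le_exp]
    linarith [neg_abs_le (Real.log ε)]
  have h2 : 1 ≤ Real.exp (5 * |Real.log ε|) := Real.one_le_exp (by positivity)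
  have h3 : 1 ≤ ℓ ^ 12 := one_le_pow₀ hℓ1
  have h4 : 1 + d * (ℓ ^ 12 / ε ^ 5) ≤ (1 + d) * (ℓ ^ 12 * Real.exp (5 * |Real.log ε|)) := by
    have h5 : ℓ ^ 12 / ε ^ 5 ≤ ℓ ^ 12 * Real.exp (5 * |Real.log ε|) := by
      rw [div_eq_mul_one_div]
      exact mul_le_mul_of_nonneg_left h1 (by positivity)
    have h6 := mul_le_mul_of_nonneg_left h5 hd
    have h7 := one_le_mul_of_one_le_of_one_le h3 h2
    linarith
  refine (Real.log_le_log (by positivity) h4).trans ?_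
  rw [Real.log_mul (by positivity) (by positivity), Real.log_mul (by positivity) (by positivity),
    Real.log_exp, Real.log_pow]
  have h5 := Real.log_le_sub_one_of_pos (by linarith : 0 < 1 + d)
  have h6 := Real.log_le_sub_one_of_pos hℓ0
  have h7 := mul_le_mul_of_nonneg_left hℓ1 hd
  push_cast
  linarith

namespace Problem

variable {n l m : ℕ} {P : Problem n l m} {c : Params m}

theorem exists_outerConstants (hP : P.Assumptions c) {κ : ℝ} (hB : P.UniformBound c κ) {v : ℝ}
    (hv : 0 < v) (x0 : Vec n) {εmax : ℝ} (hε : 0 < εmax) :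
    ∃ R E I, P.OuterConstants c v x0 εmax κ R E I := by
  have hβ := hP.beta_pos
  have hw := hP.w_pos
  have hσ := zero_lt_one.trans hP.sigma_gt
  have hκ := zero_le_one.trans hB.one_le
  refine ⟨c.β₀ * P.residual x0 + c.σ * (εmax + κ + 2 * c.w₀ * κ ^ 2) / v, _, _, ?_, ?_, ?_,
    le_rfl, le_rfl⟩
  · have := P.residual_nonneg x0
    positivity
  · exact le_add_of_nonneg_right (by positivity)
  · rw [mul_add v, mul_div_cancel₀ _ hv.ne']
    have := P.residual_nonneg x0
    exact le_add_of_nonneg_left (by positivity)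

end Problem

end IALM

theorem mainTheorem4 {n l m : ℕ} (P : IALM.Problem n l m) (c : IALM.Params m)
    (hP : P.Assumptions c) (v : ℝ) (hv : 0 < v)
    (x0 : IALM.Vec n) (hx0 : x0 ∈ P.dom) (εmax : ℝ) (hεmax : 0 < εmax) :
    ∃ (C : ℝ) (p : ℕ), ∀ ε : ℝ, 0 < ε → ε ≤ εmax →
      ∀ xm : ℕ → IALM.Vec n, (∀ N, xm N ∈ P.dom) →
        P.Regular c v (P.run c ε x0 xm) →
          ∃ (N k : ℕ) (x : IALM.Vec n),
            IALM.Problem.Produces (P.run c ε x0 xm) N k x ∧ P.IsKKT ε x ∧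
              (N : ℝ) ≤ C * ε ^ (-(5 / 2 : ℝ)) * (1 + |Real.log ε|) ^ p := by
  obtain ⟨κ, hB⟩ := IALM.Problem.exists_uniformBound hP ⟨x0, hx0⟩
  obtain ⟨R, E, I, hC⟩ := IALM.Problem.exists_outerConstants hP hB hv x0 hεmax
  have hβ := hP.beta_pos
  have hw := hP.w_pos
  have hρ := hP.rho_pos
  have hκ := zero_le_one.trans hB.one_le
  have hR := hC.R_nonneg
  have hE : 0 ≤ E := le_trans (by positivity) hC.E_ge
  have hI : 0 ≤ I := le_trans (by positivity) hC.I_ge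
  have hΛ := IALM.Problem.lipConst_pos hP
  set A := R + m * (c.w₀ * κ * R + R ^ 2 + (c.w₀ * κ) ^ 2) with hA
  have hA0 : 0 ≤ A := by positivity
  -- `A` may vanish, while a positive constant is required.
  obtain ⟨a, ha, hidx⟩ := IALM.exists_outer_index (A := A + 1) (εmax := εmax) hP.sigma_gt hβ
    (by linarith)
  have ha0 := zero_le_one.trans ha
  set M := |P.g x0 + P.h x0| + 2 * κ + I + 2 * E with hM
  have hM0 : 0 ≤ M := by positivity
  set b := P.lipConst c * a ^ 4 with hb
  have hb0 : 0 ≤ b := by positivity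
  set d := 256 * b ^ 3 * κ ^ 2 / c.ρ₀ with hd
  have hd0 : 0 ≤ d := by positivity
  set w₁ := √(b / c.ρ₀) * (d + 17) + 2 * √εmax with hw₁
  set j₁ := 96 * c.ρ₀ * M * a ^ 3 + εmax ^ 2 with hj₁
  -- The power 7 = 1 + 3 + 3 collects the outer count, the (K+1)³ in the gap, and the APG count with
  -- ℓ² from the square root and ℓ from the logarithm. The εmax terms in `j₁` and `w₁` absorb
  -- additive constants.
  refine ⟨a * j₁ * w₁, 7, fun ε hε hε' xm hxm hreg => ?_⟩
  obtain ⟨K, hK1, hK2, hK3⟩ := hidx ε hε hε'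
  have hlog := IALM.log_one_add_le hd0 hε
  set ℓ := 1 + |Real.log ε| with hℓ
  have hℓ1 : 1 ≤ ℓ := le_add_of_nonneg_right (abs_nonneg _)
  have hℓ0 : 0 < ℓ := by linarith
  have hs : 0 < √ε := Real.sqrt_pos.2 hε
  have hLb : P.lipConst c * (K + 1) * IALM.Problem.beta c K ≤ b * (ℓ ^ 4 / ε) := by
    calc P.lipConst c * (K + 1) * IALM.Problem.beta c K
        ≤ P.lipConst c * (K + 1) * (a * ((K : ℝ) + 1) ^ 2 / ε) := by
          gcongr
          exact hK2
      _ = P.lipConst c * a * ((K : ℝ) + 1) ^ 3 / ε := by ring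
      _ ≤ P.lipConst c * a * (a * ℓ) ^ 3 / ε := by gcongr
      _ = b * (ℓ ^ 3 / ε) := by rw [hb]; ring
      -- The exponent is rounded up to an even number so that the square root in `hsqrt` is an
      -- integer power of ℓ.
      _ ≤ b * (ℓ ^ 4 / ε) := by
          gcongr
          norm_num
  have hsqrt : √(b * (ℓ ^ 4 / ε) / c.ρ₀) = √(b / c.ρ₀) * (ℓ ^ 2 * (√ε)⁻¹) := by
    have e : b * (ℓ ^ 4 / ε) / c.ρ₀ = b / c.ρ₀ * ((ℓ ^ 2) ^ 2 / ε) := by ring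
    rw [e, Real.sqrt_mul (by positivity), Real.sqrt_div (by positivity : 0 ≤ (ℓ ^ 2) ^ 2),
      Real.sqrt_sq (by positivity), div_eq_mul_inv (ℓ ^ 2)]
  have hlog' : Real.log (1 + 256 * (b * (ℓ ^ 4 / ε)) ^ 3 * κ ^ 2 / (c.ρ₀ * ε ^ 2))
      ≤ (d + 17) * ℓ := by
    refine le_trans (le_of_eq ?_) hlog
    congr 2
    rw [hd]
    field_simp
  have hW : √(b * (ℓ ^ 4 / ε) / c.ρ₀)
      * Real.log (1 + 256 * (b * (ℓ ^ 4 / ε)) ^ 3 * κ ^ 2 / (c.ρ₀ * ε ^ 2)) + 1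
      ≤ √(b / c.ρ₀) * (ℓ ^ 2 * (√ε)⁻¹) * ((d + 17) * ℓ) + 1 := by
    rw [hsqrt]
    gcongr
  have hJ : M * ((K : ℝ) + 1) ^ 3 < ((⌊96 * c.ρ₀ * M * (a * ℓ) ^ 3 / ε ^ 2⌋₊ : ℕ) + 1 : ℝ)
      * (ε ^ 2 / (96 * c.ρ₀)) := by
    have h1 := Nat.lt_floor_add_one (96 * c.ρ₀ * M * (a * ℓ) ^ 3 / ε ^ 2)
    have h2 := mul_lt_mul_of_pos_right h1 (by positivity : 0 < ε ^ 2 / (96 * c.ρ₀))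
    refine lt_of_le_of_lt ?_ h2
    have e : 96 * c.ρ₀ * M * (a * ℓ) ^ 3 / ε ^ 2 * (ε ^ 2 / (96 * c.ρ₀)) = M * (a * ℓ) ^ 3 := by
      field_simp
    rw [e]
    gcongr
  obtain ⟨N, k, x, hprod, hkkt, hN⟩ := IALM.Problem.exists_kkt_of_bounds hP hx0 hB hC hv hε hε' hxm
    hreg ((mul_le_mul_of_nonneg_right (le_add_of_nonneg_right zero_le_one) (sq_nonneg _)).trans hK1)
    hLb hW hJ
  refine ⟨N, k, x, hprod, hkkt, hN.trans ?_⟩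
  have hJ' : ((⌊96 * c.ρ₀ * M * (a * ℓ) ^ 3 / ε ^ 2⌋₊ : ℕ) + 1 : ℝ) ≤ j₁ * ℓ ^ 3 * (ε ^ 2)⁻¹ := by
    have h1 := Nat.floor_le (by positivity : 0 ≤ 96 * c.ρ₀ * M * (a * ℓ) ^ 3 / ε ^ 2)
    have h2 : 1 ≤ εmax ^ 2 * ℓ ^ 3 * (ε ^ 2)⁻¹ := by
      rw [← div_eq_mul_inv, one_le_div (by positivity)]
      calc ε ^ 2 ≤ εmax ^ 2 := by gcongr
        _ ≤ εmax ^ 2 * ℓ ^ 3 := le_mul_of_one_le_right (by positivity) (one_le_pow₀ hℓ1)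
    have e : j₁ * ℓ ^ 3 * (ε ^ 2)⁻¹ = 96 * c.ρ₀ * M * (a * ℓ) ^ 3 / ε ^ 2
        + εmax ^ 2 * ℓ ^ 3 * (ε ^ 2)⁻¹ := by rw [hj₁]; ring
    linarith
  have hW' : √(b / c.ρ₀) * (ℓ ^ 2 * (√ε)⁻¹) * ((d + 17) * ℓ) + 1 + 1
      ≤ w₁ * ℓ ^ 3 * (√ε)⁻¹ := by
    have h2 : 1 ≤ √εmax * ℓ ^ 3 * (√ε)⁻¹ := by
      rw [← div_eq_mul_inv, one_le_div hs]
      calc √ε ≤ √εmax := Real.sqrt_le_sqrt hε'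
        _ ≤ √εmax * ℓ ^ 3 := le_mul_of_one_le_right (by positivity) (one_le_pow₀ hℓ1)
    have e : w₁ * ℓ ^ 3 * (√ε)⁻¹ = √(b / c.ρ₀) * (ℓ ^ 2 * (√ε)⁻¹) * ((d + 17) * ℓ)
        + 2 * (√εmax * ℓ ^ 3 * (√ε)⁻¹) := by rw [hw₁]; ring
    linarith
  rw [IALM.rpow_neg_five_halves hε]
  calc ((K : ℝ) + 1) * (((⌊96 * c.ρ₀ * M * (a * ℓ) ^ 3 / ε ^ 2⌋₊ : ℕ) + 1 : ℝ)
        * (√(b / c.ρ₀) * (ℓ ^ 2 * (√ε)⁻¹) * ((d + 17) * ℓ) + 1 + 1))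
      ≤ (a * ℓ) * ((j₁ * ℓ ^ 3 * (ε ^ 2)⁻¹) * (w₁ * ℓ ^ 3 * (√ε)⁻¹)) := by gcongr
    _ = a * j₁ * w₁ * ((ε ^ 2)⁻¹ * (√ε)⁻¹) * ℓ ^ 7 := by ring
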